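/- Let $\mathfrak g$ be a finite-dimensional complex simple Lie algebra, $\mathfrak h$ a Cartan subalgebra, $l=\dim\mathfrak h$, and $(\cdot|\cdot)$ the Killing form in any normalization (any non-zero multiple of $(X,Y)\mapsto \operatorname{tr}(\operatorname{ad}X\operatorname{ad}Y)$), by which $\mathfrak h$ and $\mathfrak h^*$ are identified. Let $\rho\in\mathfrak h$ be the half sum of the positive roots with respect to a choice of simple roots, let $(H_i)$ be a basis of $\mathfrak h$ with dual basis $(H^i)$, and let $\kappa\in\mathbb C^\times$. Free bosons $\phi_i[m]$ ($m\in\mathbb Z$) satisfy $[\phi_i[m],\phi_j[n]]=\kappa(H_i|H_j)\,m\,\delta_{m+n,0}$; write $\phi[h;m]=\sum_i a_i\phi_i[m]$ for $h=\sum_i a_iH_i$. The Fock space $F_\lambda$ ($\lambda\in\mathfrak h$) is generated by $|\lambda\rangle$ with $\phi[h;m]|\lambda\rangle=0$ for $m>0$ and $\phi[h;0]|\lambda\rangle=(\lambda|h)|\lambda\rangle$; it has the basis of monomials in the $\phi_i[-n]$ ($n\ge1$) applied to $|\lambda\rangle$. The operator $e^{p[h]}$ on $\bigoplus_\lambda F_\lambda$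 sends $|\lambda\rangle$ to $|\lambda+h\rangle$ and commutes with $\phi_i[m]$, $m\neq0$. Put $$V(h;z)=\exp\Bigl(\tfrac1\kappa\sum_{m<0}\tfrac{z^{-m}}{-m}\phi[h;m]\Bigr)\,e^{p[h]}\,z^{\phi[h;0]/\kappa}\,\exp\Bigl(\tfrac1\kappa\sum_{m>0}\tfrac{z^{-m}}{-m}\phi[h;m]\Bigr),$$ $$T^\phi[0]=\tfrac1{2\kappa}\sum_i\sum_{m\in\mathbb Z}{:}\phi[H_i;m]\,\phi[H^i;-m]{:}\;+\;\tfrac1{2\kappa}\phi[2\rho;0],$$ where in the normal ordered product the mode with positive index stands on the right. Let $\mu,H\in\mathfrak h$, $N\ge0$, and $\mu_1,\dots,\mu_N\in\mathfrak h$ with $\sum_i\mu_i=0$. Let $\tau,x_1,\dots,x_N\in\mathbb C$ with $\operatorname{Im}\tau>0$, and put $q=e^{2\pi i\tau}$, $z_j=e^{2\pi i x_j}$; powers of $q$ and $z_j$ are $q^a=e^{2\pi i a\tau}$, $z_j^a=e^{2\pi i a x_j}$. Assume $|z_j|<|z_i|$ and $|q z_i|<|z_j|$ for all $i<j$ (that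 is, $|z_1|>\dots>|z_N|>|qz_1|$). Then all sums over intermediate basis states in the product $V(\mu_1;z_1)\cdots V(\mu_N;z_N)\,q^{T^\phi[0]}e^{\phi[H;0]}$ converge absolutely, and its trace over $F_\mu$ (the sum of its diagonal matrix elements in the monomial basis) converges absolutely, with $$\operatorname{Tr}_{F_\mu}\bigl(V(\mu_1;z_1)\cdots V(\mu_N;z_N)\,q^{T^\phi[0]}e^{\phi[H;0]}\bigr) =(q;q)_\infty^{-l}\,q^{\Delta_\mu}\,e^{(H|\mu)}\prod_{i=1}^N\Bigl(\bigl(\sqrt{-1}\,\eta(q)^3\bigr)^{\frac{(\mu_i|\mu_i)}{2\kappa}}z_i^{\frac{(\mu_i|2\mu-\mu_i)}{2\kappa}}\Bigr)\prod_{1\le i<j\le N}\theta_{11}(z_i/z_j;q)^{\frac{(\mu_i|\mu_j)}{\kappa}}.$$ Here $\Delta_\mu=(\mu|\mu+2\rho)/2\kappa$, $(a;q)_\infty=\prod_{n\ge0}(1-aq^n)$, $\eta(q)=q^{1/24}(q;q)_\infty$, and, for $z=e^{2\pi i x}$, $$\theta_{11}(z;q)=\sum_{n\in\mathbb Z}e^{(n+1/2)^2\pi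 i\tau+2\pi i(n+1/2)(x+1/2)},$$ taken at $x=x_i-x_j$ for $z=z_i/z_j$. With $\log(a;q)_\infty:=\sum_{n\ge0}\operatorname{Log}(1-aq^n)$ for $|a|,|q|<1$ (principal $\operatorname{Log}$), the complex powers of $\sqrt{-1}\,\eta^3$ and $\theta_{11}$ are formed with $$\log(\sqrt{-1}\,\eta(q)^3)=\tfrac{\pi i}2+3\Bigl(\tfrac{2\pi i\tau}{24}+\log(q;q)_\infty\Bigr),$$ $$\log\theta_{11}(z;q)=\tfrac{\pi i}2+\tfrac{2\pi i\tau}8+\pi i x+\log(q;q)_\infty+\log(z^{-1};q)_\infty+\log(qz;q)_\infty ,$$ and these are indeed logarithms of $\sqrt{-1}\,\eta(q)^3$ and (for $z=z_i/z_j$, $i<j$) of $\theta_{11}(z;q)$. -/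

import Mathlib

noncomputable section

namespace OneLoop

/-! ### Special functions -/

/-- `(a;q)_∞ = ∏_{n ≥ 0} (1 - a q^n)`. -/
def qPochhammer (a q : ℂ) : ℂ := ∏' n : ℕ, (1 - a * q ^ n)

/-- The branch `∑_{n ≥ 0} Log (1 - a q^n)` (principal `Log`) of `log (a;q)_∞` on
`|a| < 1`, `|q| < 1`; it vanishes at `a = 0`. -/
def logQPochhammer (a q : ℂ) : ℂ := ∑' n : ℕ, Complex.log (1 - a * q ^ n)

/-- `e^{2πi x}`. -/
def expTwoPiI (x : ℂ) : ℂ := Complex.exp (2 * Real.pi * Complex.I * x)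

/-- The theta function with characteristic `(1/2, 1/2)`, in the additive variable `x`
(the multiplicative one is `z = e^{2πi x}`). -/
def theta11 (x τ : ℂ) : ℂ :=
  ∑' n : ℤ, Complex.exp (((n : ℂ) + 1 / 2) ^ 2 * Real.pi * Complex.I * τ
    + 2 * Real.pi * Complex.I * ((n : ℂ) + 1 / 2) * (x + 1 / 2))

/-- The Dedekind eta function `q^{1/24} (q;q)_∞`, `q = e^{2πi τ}`. -/
def dedekindEta (τ : ℂ) : ℂ :=
  expTwoPiI (τ / 24) * qPochhammer (expTwoPiI τ) (expTwoPiI τ)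

/-- The branch of `log (√-1 η(q)³)` on the upper half-plane used to form complex powers. -/
def logIEtaCubed (τ : ℂ) : ℂ :=
  Real.pi * Complex.I / 2
    + 3 * (2 * Real.pi * Complex.I * τ / 24
      + logQPochhammer (expTwoPiI τ) (expTwoPiI τ))

/-- The branch of `log θ₁₁(z;q)`, `z = e^{2πi x}`, on the simply connected domain
`|q| < |qz| < 1` of the variables `(x, τ)` used to form complex powers. -/
def logTheta11 (x τ : ℂ) : ℂ :=
  Real.pi * Complex.I / 2 + 2 * Real.pi * Complex.I * τ / 8 + Real.pi * Complex.I * x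
    + logQPochhammer (expTwoPiI τ) (expTwoPiI τ)
    + logQPochhammer (expTwoPiI x)⁻¹ (expTwoPiI τ)
    + logQPochhammer (expTwoPiI τ * expTwoPiI x) (expTwoPiI τ)

/-! ### Free bosons and Fock spaces

`V` plays the role of the Cartan subalgebra, identified with its dual by the form `B`, and
`b = (H_i)` is a basis of it.  The Fock space `F_lam` has the basis
`∏ φ_i[-n]^{α (i, n)} |lam⟩`, so it is the space of polynomials in `φ_i[-n]`, `n ≥ 1`. -/

section Fock

variable {ι V : Type*}

/-- The direct sum `⨁_lam F_lam` of all Fock spaces. -/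
abbrev FockSum (ι V : Type*) := V →₀ MvPolynomial (ι × ℕ+) ℂ

/-- The labels `(lam, α)` of the basis vectors `∏ φ_i[-n]^{α (i, n)} |lam⟩`. -/
abbrev FockState (ι V : Type*) := V × ((ι × ℕ+) →₀ ℕ)

/-- The basis vector `∏ φ_i[-n]^{α (i, n)} |lam⟩`. -/
def ket (s : FockState ι V) : FockSum ι V := Finsupp.single s.1 (MvPolynomial.monomial s.2 1)

/-- Operators from `⨁_lam F_lam` to its completion, given by their matrix elements:
`A s t` is the coefficient of `ket s` in `A (ket t)`. -/
abbrev FockOp (ι V : Type*) := FockState ι V → FockState ι V → ℂ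

/-- The matrix elements of an endomorphism. -/
def toOp (A : Module.End ℂ (FockSum ι V)) : FockOp ι V :=
  fun s t => MvPolynomial.coeff s.2 (A (ket t) s.1)

open Classical in
/-- The identity operator. -/
def opOne (ι V : Type*) : FockOp ι V := fun s t => if s = t then 1 else 0

/-- Product of operators: the sum over intermediate states. -/
def opMul (A A' : FockOp ι V) : FockOp ι V := fun s t => ∑' u, A s u * A' u t

/-- Powers of an operator. -/
def opPow (A : FockOp ι V) : ℕ → FockOp ι V
  | 0 => opOne ι V
  | k + 1 => opMul A (opPow A k)

/-- The exponential of an operator, `∑_k A^k / k!`, entry by entry. -/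
def opExp (A : FockOp ι V) : FockOp ι V := fun s t => ∑' k : ℕ, opPow A k s t / k.factorial

/-- The product `A₁ A₂ ⋯ A_r` of a list of operators. -/
def opProd : List (FockOp ι V) → FockOp ι V
  | [] => opOne ι V
  | A :: L => opMul A (opProd L)

/-- All sums over intermediate states in the product `A₁ (A₂ (⋯ A_r))` converge absolutely. -/
def OpProdConverges : List (FockOp ι V) → Prop
  | [] => True
  | A :: L => (∀ s t, Summable fun u => A s u * opProd L u t) ∧ OpProdConverges L

/-- The operator `A` has the (absolutely convergent) trace `a` over the Fock space `F_mu`. -/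
def HasFockTrace (mu : V) (A : FockOp ι V) (a : ℂ) : Prop :=
  HasSum (fun α : (ι × ℕ+) →₀ ℕ => A (mu, α) (mu, α)) a

variable [AddCommGroup V]

/-- The boost operator `e^{p[h]}`: it shifts the momentum by `h` and commutes with
`φ_i[m]`, `m ≠ 0`. -/
def boost (ι : Type*) {V : Type*} [AddCommGroup V] (h : V) : Module.End ℂ (FockSum ι V) :=
  Finsupp.lmapDomain (MvPolynomial (ι × ℕ+) ℂ) ℂ fun lam => lam + h

variable [Module ℂ V] [Fintype ι]

/-- The action of `φ[h;m]` on the Fock space of momentum `lam`: multiplication by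
`∑ a_i φ_i[m]` (`h = ∑ a_i H_i`) if `m < 0`, the scalar `(lam|h)` if `m = 0`, and the
derivation `φ_i[-m] ↦ κ m (h|H_i)` if `m > 0`. -/
def fockMode (κ : ℂ) (B : LinearMap.BilinForm ℂ V) (b : Module.Basis ι ℂ V) (lam h : V) :
    ℤ → Module.End ℂ (MvPolynomial (ι × ℕ+) ℂ)
  | Int.ofNat 0 => B lam h • LinearMap.id
  | Int.ofNat (n + 1) =>
      ∑ i, (κ * (n + 1) * B h (b i)) • (MvPolynomial.pderiv (i, n.succPNat)).toLinearMap
  | Int.negSucc n =>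
      LinearMap.mulLeft ℂ (∑ i, MvPolynomial.C (b.repr h i) * MvPolynomial.X (i, n.succPNat))

/-- `φ[h;m]` on `⨁_lam F_lam`. -/
def phi (κ : ℂ) (B : LinearMap.BilinForm ℂ V) (b : Module.Basis ι ℂ V) (h : V) (m : ℤ) :
    Module.End ℂ (FockSum ι V) :=
  Finsupp.lsum ℂ fun lam => Finsupp.lsingle lam ∘ₗ fockMode κ B b lam h m

/-- The half `(1/κ) ∑ z^{-m}/(-m) φ[h;m]` of the mode expansion of `φ(h;z)/κ`, the sum
running over `m = -1, -2, …` for `ε = -1` and over `m = 1, 2, …` for `ε = 1`; every matrix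
element is a finite sum. -/
def halfField (κ : ℂ) (B : LinearMap.BilinForm ℂ V) (b : Module.Basis ι ℂ V) (h : V) (z : ℂ)
    (ε : ℤ) : FockOp ι V :=
  fun s t => (1 / κ) * ∑' n : ℕ,
    z ^ (-(ε * (n + 1))) / (-(ε * (n + 1)) : ℤ) * toOp (phi κ B b h (ε * (n + 1))) s t

/-- The bosonic vertex operator `V(h;z) = :e^{φ(h;z)/κ}:` at `z = e^{2πi x}`, `log z = 2πi x`:
`exp(creation part) e^{p[h]} z^{φ[h;0]/κ} exp(annihilation part)`. -/
def vertexOp (κ : ℂ) (B : LinearMap.BilinForm ℂ V) (b : Module.Basis ι ℂ V) (h : V) (x : ℂ) :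
    FockOp ι V :=
  opProd
    [ opExp (halfField κ B b h (expTwoPiI x) (-1)),
      toOp (boost ι h),
      opExp (fun s t => 2 * Real.pi * Complex.I * x / κ * toOp (phi κ B b h 0) s t),
      opExp (halfField κ B b h (expTwoPiI x) 1) ]

/-- The normal ordered product `:φ[h;m] φ[h';-m]:`. -/
def normalOrdered (κ : ℂ) (B : LinearMap.BilinForm ℂ V) (b : Module.Basis ι ℂ V) (h h' : V)
    (m : ℤ) : Module.End ℂ (FockSum ι V) :=
  if 0 < m then phi κ B b h' (-m) * phi κ B b h m else phi κ B b h m * phi κ B b h' (-m)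

/-- The zero mode `T^φ[0]` (coefficient of `z^{-2}`) of
`(1/2κ) ∑_i :∂φ(H_i;z) ∂φ(H^i;z): - (1/2κ) ∂²φ(2ρ;z)`, where `(H^i)` is the basis dual
to `(H_i)`; the coefficient of `z^{-2}` in `∂²φ(2ρ;z)` is `-φ[2ρ;0]`. Every matrix element
of the sum over `m` is a finite sum. -/
def energyZeroMode [DecidableEq ι] (κ : ℂ) (B : LinearMap.BilinForm ℂ V) (hB : B.Nondegenerate)
    (b : Module.Basis ι ℂ V) (ρ : V) : FockOp ι V :=
  fun s t =>
    1 / (2 * κ) * ∑ i, ∑' m : ℤ, toOp (normalOrdered κ B b (b i) (B.dualBasis hB b i) m) s t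
      + 1 / (2 * κ) * toOp (phi κ B b ((2 : ℂ) • ρ) 0) s t

/-- The operators in `V(μ_1;z_1) ⋯ V(μ_N;z_N) q^{T^φ[0]} e^{φ[H;0]}`, from left to right,
where `z_i = e^{2πi x_i}` and `q = e^{2πi τ}`. -/
def oneLoopOps [DecidableEq ι] (κ : ℂ) (B : LinearMap.BilinForm ℂ V) (hB : B.Nondegenerate)
    (b : Module.Basis ι ℂ V) (ρ H : V) {N : ℕ} (μs : Fin N → V) (x : Fin N → ℂ) (τ : ℂ) :
    List (FockOp ι V) :=
  List.ofFn (fun i => vertexOp κ B b (μs i) (x i)) ++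
    [ opExp (fun s t => 2 * Real.pi * Complex.I * τ * energyZeroMode κ B hB b ρ s t),
      opExp (toOp (phi κ B b H 0)) ]

end Fock

/-! ### The explicit formula -/

/-- The right-hand side `ℓ_{μ_1,…,μ_N,μ}(z_1,…,z_N;q;H)`, with `z_i = e^{2πi x_i}`,
`q = e^{2πi τ}`, `z_i^a = e^{2πi a x_i}`, `q^a = e^{2πi a τ}`. -/
def oneLoopFormula {V : Type*} [AddCommGroup V] [Module ℂ V] (κ : ℂ)
    (B : LinearMap.BilinForm ℂ V) (ρ H mu : V) {N : ℕ} (μs : Fin N → V) (x : Fin N → ℂ)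
    (τ : ℂ) : ℂ :=
  (qPochhammer (expTwoPiI τ) (expTwoPiI τ) ^ Module.finrank ℂ V)⁻¹
    * expTwoPiI (B mu (mu + (2 : ℂ) • ρ) / (2 * κ) * τ)
    * Complex.exp (B H mu)
    * (∏ i, Complex.exp (B (μs i) (μs i) / (2 * κ) * logIEtaCubed τ)
        * expTwoPiI (B (μs i) ((2 : ℂ) • mu - μs i) / (2 * κ) * x i))
    * ∏ i, ∏ j ∈ Finset.Ioi i,
        Complex.exp (B (μs i) (μs j) / κ * logTheta11 (x i - x j) τ)

/-! ### The Cartan subalgebra of a simple Lie algebra -/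

section Cartan

/-- The restriction to `𝔥` of `c` times the Killing form `(X, Y) ↦ tr (ad X ad Y)` of `𝔤`. -/
def cartanForm {𝔤 : Type*} [LieRing 𝔤] [LieAlgebra ℂ 𝔤] (𝔥 : LieSubalgebra ℂ 𝔤)
    (c : ℂ) : LinearMap.BilinForm ℂ 𝔥 :=
  c • LieModule.traceForm ℂ 𝔥 𝔤

variable {𝔤 : Type*} [LieRing 𝔤] [LieAlgebra ℂ 𝔤] [FiniteDimensional ℂ 𝔤]
  [LieAlgebra.IsSimple ℂ 𝔤] (𝔥 : LieSubalgebra ℂ 𝔤) [𝔥.IsCartanSubalgebra]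

theorem cartanForm_nondegenerate {c : ℂ} (hc : c ≠ 0) : (cartanForm 𝔥 c).Nondegenerate := by
  have h := LieAlgebra.IsKilling.traceForm_cartan_nondegenerate ℂ 𝔤 𝔥
  refine ⟨fun v hv => h.1 v fun w => ?_, fun v hv => h.2 v fun w => ?_⟩
  · simpa [cartanForm, hc] using hv w
  · simpa [cartanForm, hc] using hv w

open Classical in
/-- The half sum `ρ` of the positive roots, as an element of `𝔥` via the form `cartanForm 𝔥 c`. -/
def weylVector (base : (LieAlgebra.IsKilling.rootSystem 𝔥).Base) {c : ℂ} (hc : c ≠ 0) : 𝔥 :=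
  ((cartanForm 𝔥 c).toDual (cartanForm_nondegenerate 𝔥 hc)).symm
    ((1 / 2 : ℂ) • ∑ α : 𝔥.root with base.IsPos α, (LieAlgebra.IsKilling.rootSystem 𝔥).root α)

end Cartan

end OneLoop

end

/-! The Fock space is a polynomial ring in the creation modes, and on it every factor of the product
is Gaussian: with C, D families of scalars indexed by the oscillators (i, n), a vertex operator is
`e^{∑ C x} e^{∑ D ∂}` times a momentum shift and a scalar depending on the momentum
(`vertexOp_eq_gaussOp`). Gaussian operators are closed under composition, since `e^{d∂} e^{Cx} =
e^{dC} e^{Cx} e^{d∂}`. For i < j, reordering factors i and j therefore costs `exp (∑ d C)`, and the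
sum is `(μ_i|μ_j)/κ · Log (1 - z_j/z_i)`; it converges because |z_j| < |z_i| (`opProd_gaussOp`,
`hasSum_annihilationCoeff_mul_creationCoeff_log`).

The operator `q^{T[0]} e^{φ[H;0]}` is diagonal, with oscillator part `∏ (q^n)^{α(i,n)}`
(`energyZeroMode_eq_diagOp`). As `∑ μ_i = 0`, the product preserves the momentum, and its trace
factors over the oscillators. One oscillator contributes `∑_a ⟨a|e^{cx}e^{d∂}|a⟩ w^a =
e^{cdw/(1-w)}/(1-w)` with w = q^n (`hasSum_gaussEntry_diag`). The denominators give `(q;q)_∞^{-l}`.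
The exponents are Lambert series `∑ y^n q^n / (n(1-q^n)) = -log (qy;q)_∞` at y = z_k/z_j, for all
pairs (j, k); they converge because |q z_k| < |z_j| (`hasSum_lambert`).

What remains is additive bookkeeping of logarithms: the vanishing row sums of `(μ_i|μ_j)`
redistribute the diagonal and constant terms into powers of `√-1 η³` and of θ₁₁
(`exponent_identity`, `oneLoop_exponent`). The identity holds between the chosen logarithms
themselves, so no branch ambiguity arises. That these are logarithms of the theta series and of `√-1
η³` follows from the Jacobi triple product and from the product for η.

Absolute convergence is obtained by running the same one-oscillator identities over ℝ on the norms
of the coefficients; this is why that section is stated for `RCLike` fields. -/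

noncomputable section

namespace OneLoop

open Finset hiding mem_antidiagonal
open Finset.HasAntidiagonal (mem_antidiagonal)

/-! ### A single oscillator -/

section Oscillator

variable {𝕜 : Type*} [RCLike 𝕜]

/-- The matrix of `e^{d ∂}` in the basis `x^k`. -/
def lowering (d : 𝕜) (k b : ℕ) : 𝕜 := d ^ (b - k) * b.choose k

/-- The matrix of the multiplication by `e^{c x}` in the basis `x^k`. -/
def raising (c : 𝕜) (a k : ℕ) : 𝕜 := lowering c k a * (k.factorial / a.factorial)

/-- The matrix of `e^{c x} e^{d ∂}` in the basis `x^k`. -/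
def gaussEntry (c d : 𝕜) (a b : ℕ) : 𝕜 := ∑ k ∈ range (a + 1), raising c a k * lowering d k b

lemma lowering_of_lt (d : 𝕜) {k b : ℕ} (h : b < k) : lowering d k b = 0 := by
  simp [lowering, Nat.choose_eq_zero_of_lt h]

lemma raising_of_lt (c : 𝕜) {a k : ℕ} (h : a < k) : raising c a k = 0 := by
  simp [raising, lowering_of_lt c h]

lemma raising_add (c : 𝕜) (k v : ℕ) : raising c (k + v) k = c ^ v / v.factorial := by
  have h1 : ((k + v).factorial : 𝕜) ≠ 0 := by exact_mod_cast (k + v).factorial_ne_zero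
  have h2 : (v.factorial : 𝕜) ≠ 0 := by exact_mod_cast v.factorial_ne_zero
  have h3 : ((k + v).choose k * k.factorial * v.factorial : 𝕜) = (k + v).factorial := by
    rw [Nat.choose_symm_add]
    exact_mod_cast Nat.add_choose_mul_factorial_mul_factorial k v
  rw [raising, lowering, Nat.add_sub_cancel_left]
  field_simp
  linear_combination c ^ v * h3

lemma gaussEntry_eq_sum_range {n a : ℕ} (c d : 𝕜) (b : ℕ) (h : a < n) :
    gaussEntry c d a b = ∑ k ∈ range n, raising c a k * lowering d k b := by
  refine sum_subset (range_subset_range.2 h) fun k _ hk => ?_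
  rw [raising_of_lt c (by simpa using hk), zero_mul]

lemma gaussEntry_eq_sum_range_right {n b : ℕ} (c d : 𝕜) (a : ℕ) (h : b < n) :
    gaussEntry c d a b = ∑ k ∈ range n, raising c a k * lowering d k b := by
  rw [gaussEntry_eq_sum_range c d b (show a < a + n + 1 by omega)]
  refine (sum_subset (range_subset_range.2 (by omega)) fun k _ hk => ?_).symm
  rw [lowering_of_lt d (h.trans_le (by simpa using hk)), mul_zero]

/-- The translations `x ↦ x + d` form a one-parameter group; on coefficients this is the binomial
theorem. -/
lemma sum_lowering_mul_lowering (d D : 𝕜) (j b : ℕ) :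
    ∑ l ∈ range (b + 1), lowering d j l * lowering D l b = lowering (d + D) j b := by
  rcases lt_or_ge b j with h | h
  · rw [lowering_of_lt _ h]
    refine sum_eq_zero fun l hl => ?_
    rw [lowering_of_lt d (by simp at hl; omega), zero_mul]
  · obtain ⟨m, rfl⟩ := Nat.exists_eq_add_of_le h
    rw [add_assoc, sum_range_add, sum_eq_zero, zero_add]
    · rw [lowering, Nat.add_sub_cancel_left, add_pow, sum_mul]
      refine sum_congr rfl fun l hl => ?_
      have hl' : l ≤ m := by simp at hl; omega
      have h1 : ((j + m).choose (j + l) * (j + l).choose j : 𝕜)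
          = (j + m).choose j * m.choose l := by
        have := Nat.choose_mul (n := j + m) (k := j + l) (s := j) (by omega)
        simp only [Nat.add_sub_cancel_left] at this
        exact_mod_cast this
      rw [lowering, lowering, Nat.add_sub_cancel_left, Nat.add_sub_add_left]
      linear_combination d ^ l * D ^ (m - l) * h1
    · intro l hl
      rw [lowering_of_lt d (by simpa using hl), zero_mul]

lemma sum_raising_mul_raising (c C : 𝕜) (a j : ℕ) :
    ∑ k ∈ range (a + 1), raising c a k * raising C k j = raising (c + C) a j := by
  rw [raising, add_comm c, ← sum_lowering_mul_lowering, sum_mul]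
  refine sum_congr rfl fun k _ => ?_
  have h2 : (k.factorial : 𝕜) ≠ 0 := by exact_mod_cast k.factorial_ne_zero
  rw [raising, raising]
  field_simp

/-- Vandermonde's identity: `e^{d∂}` is multiplicative, so `(x+d)^{l+v} = (x+d)^l (x+d)^v`. -/
lemma lowering_add (d : 𝕜) (k l v : ℕ) :
    lowering d k (l + v) = ∑ p ∈ antidiagonal k, lowering d p.1 l * lowering d p.2 v := by
  rw [lowering, Nat.add_choose_eq, Nat.cast_sum, mul_sum]
  refine sum_congr rfl fun p hp => ?_
  rw [mem_antidiagonal] at hp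
  rcases lt_or_ge l p.1 with h | h
  · simp [lowering, Nat.choose_eq_zero_of_lt h]
  rcases lt_or_ge v p.2 with h' | h'
  · simp [lowering, Nat.choose_eq_zero_of_lt h']
  rw [lowering, lowering, show l + v - k = (l - p.1) + (v - p.2) by omega, pow_add]
  push_cast
  ring

/-- The coefficient of `x^i` in `e^{d∂} e^{Cx} = e^{dC} e^{Cx}`. -/
lemma hasSum_lowering_mul_pow (d C : 𝕜) (i : ℕ) :
    HasSum (fun v : ℕ => lowering d i v * (C ^ v / v.factorial))
      (C ^ i / i.factorial * NormedSpace.exp (d * C)) := by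
  have h0 : ∑ v ∈ range i, lowering d i v * (C ^ v / v.factorial) = 0 :=
    sum_eq_zero fun v hv => by rw [lowering_of_lt d (by simpa using hv), zero_mul]
  rw [← add_zero (C ^ i / i.factorial * NormedSpace.exp (d * C)), ← h0, ← hasSum_nat_add_iff]
  refine ((NormedSpace.expSeries_div_hasSum_exp (d * C)).mul_left
    (C ^ i / (i.factorial : 𝕜))).congr_fun fun v => ?_
  have h1 : ((v + i).factorial : 𝕜) ≠ 0 := by exact_mod_cast (v + i).factorial_ne_zero
  have h2 : (v.factorial : 𝕜) ≠ 0 := by exact_mod_cast v.factorial_ne_zero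
  have h4 : (i.factorial : 𝕜) ≠ 0 := by exact_mod_cast i.factorial_ne_zero
  have h3 : ((v + i).choose i * i.factorial * v.factorial : 𝕜) = (v + i).factorial := by
    rw [add_comm v i, Nat.choose_symm_add]
    exact_mod_cast Nat.add_choose_mul_factorial_mul_factorial i v
  rw [lowering, Nat.add_sub_cancel, mul_pow, pow_add, ← h3]
  have h5 : ((v + i).choose i : 𝕜) ≠ 0 := by
    intro h; rw [h] at h3; simp at h3; exact h1 h3.symm
  field_simp

/-- The commutation `e^{d∂} e^{Cx} = e^{dC} e^{Cx} e^{d∂}`: multiplicativity splits `(x+d)^{l+v}`,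
and the factor `(x+d)^v` is summed against the exponential series. This is the only infinite sum in
the composition law. -/
lemma hasSum_lowering_mul_raising (d C : 𝕜) (k l : ℕ) :
    HasSum (fun u : ℕ => lowering d k u * raising C u l)
      (NormedSpace.exp (d * C) * gaussEntry C d k l) := by
  have h0 : ∑ u ∈ range l, lowering d k u * raising C u l = 0 :=
    sum_eq_zero fun u hu => by rw [raising_of_lt C (by simpa using hu), mul_zero]
  rw [← add_zero (NormedSpace.exp (d * C) * _), ← h0, ← hasSum_nat_add_iff]
  have h1 : ∀ p ∈ antidiagonal k, HasSum
      (fun v : ℕ => lowering d p.1 l * (lowering d p.2 v * (C ^ v / v.factorial)))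
      (lowering d p.1 l * (C ^ p.2 / p.2.factorial * NormedSpace.exp (d * C))) := fun p _ =>
    (hasSum_lowering_mul_pow d C p.2).mul_left _
  have h2 := hasSum_sum h1
  convert! h2 using 1
  · funext v
    rw [add_comm v l, raising_add, lowering_add, sum_mul]
    exact sum_congr rfl fun p _ => by ring
  · rw [gaussEntry, ← Nat.sum_antidiagonal_eq_sum_range_succ_mk
      (fun p : ℕ × ℕ => raising C k p.1 * lowering d p.1 l) k, mul_sum]
    refine sum_congr rfl fun p hp => ?_
    rw [← mem_antidiagonal.1 hp, raising_add]
    ring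

/-- Composition of two normally ordered exponentials. -/
lemma hasSum_gaussEntry_mul_gaussEntry (c d C D : 𝕜) (a b : ℕ) :
    HasSum (fun u : ℕ => gaussEntry c d a u * gaussEntry C D u b)
      (NormedSpace.exp (d * C) * gaussEntry (c + C) (d + D) a b) := by
  have h : HasSum (fun u : ℕ => ∑ k ∈ range (a + 1), ∑ l ∈ range (b + 1),
      raising c a k * (lowering d k u * raising C u l) * lowering D l b)
      (∑ k ∈ range (a + 1), ∑ l ∈ range (b + 1),
        raising c a k * (NormedSpace.exp (d * C) * gaussEntry C d k l) * lowering D l b) :=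
    hasSum_sum fun k _ => hasSum_sum fun l _ =>
      ((hasSum_lowering_mul_raising d C k l).mul_left _).mul_right _
  convert! h using 1
  · funext u
    rw [gaussEntry, gaussEntry_eq_sum_range_right C D u (Nat.lt_succ_self b), sum_mul_sum]
    exact sum_congr rfl fun k _ => sum_congr rfl fun l _ => by ring
  -- Once the middle pair is commuted, the finite sum over `l` merges the two lowering factors, and
  -- the one over `k` merges the two raising factors.
  · have e1 : ∀ k ∈ range (a + 1), ∑ l ∈ range (b + 1),
        raising c a k * (NormedSpace.exp (d * C) * gaussEntry C d k l) * lowering D l b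
        = ∑ j ∈ range (a + 1), NormedSpace.exp (d * C) *
          (raising c a k * raising C k j * lowering (d + D) j b) := by
      intro k hk
      simp_rw [← sum_lowering_mul_lowering d D,
        gaussEntry_eq_sum_range (n := a + 1) C d _ (by simpa using hk)]
      simp_rw [mul_sum, sum_mul]
      rw [sum_comm]
      exact sum_congr rfl fun j _ => sum_congr rfl fun l _ => by ring
    rw [sum_congr rfl e1, sum_comm, gaussEntry, mul_sum]
    refine sum_congr rfl fun j _ => ?_
    rw [← mul_sum, ← sum_mul, sum_raising_mul_raising]

lemma gaussEntry_zero_zero (c d : 𝕜) : gaussEntry c d 0 0 = 1 := by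
  simp [gaussEntry, raising, lowering]

lemma norm_lowering_le (d : 𝕜) (k b : ℕ) : ‖lowering d k b‖ = lowering ‖d‖ k b := by
  simp [lowering]

lemma norm_raising_le (c : 𝕜) (a k : ℕ) : ‖raising c a k‖ = raising ‖c‖ a k := by
  simp [raising, norm_lowering_le]

lemma norm_gaussEntry_le (c d : 𝕜) (a b : ℕ) :
    ‖gaussEntry c d a b‖ ≤ gaussEntry ‖c‖ ‖d‖ a b := by
  refine (norm_sum_le _ _).trans (le_of_eq (sum_congr rfl fun k _ => ?_))
  rw [norm_mul, norm_lowering_le, norm_raising_le]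

lemma gaussEntry_diag (c d : 𝕜) (a : ℕ) :
    gaussEntry c d a a
      = ∑ p ∈ antidiagonal a, (c * d) ^ p.2 / p.2.factorial * (p.1 + p.2).choose p.2 := by
  rw [gaussEntry, ← Nat.sum_antidiagonal_eq_sum_range_succ_mk
      (fun p : ℕ × ℕ => raising c a p.1 * lowering d p.1 a) a]
  refine sum_congr rfl fun p hp => ?_
  rw [← mem_antidiagonal.1 hp, raising_add, lowering, Nat.add_sub_cancel_left, mul_pow,
    ← Nat.choose_symm_add]
  ring

lemma gaussTrace_aux {X w : 𝕜} (hw : ‖w‖ < 1) (j : ℕ) :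
    HasSum (fun k : ℕ => X ^ j / j.factorial * (k + j).choose j * w ^ (k + j))
      ((X * w / (1 - w)) ^ j / j.factorial * (1 - w)⁻¹) := by
  have h := (hasSum_choose_mul_geometric_of_norm_lt_one (𝕜 := 𝕜) j hw).mul_left
    (X ^ j / j.factorial * w ^ j)
  have h1 : 1 - w ≠ 0 := by
    intro h
    rw [← sub_eq_zero.1 h] at hw
    simp at hw
  convert! h using 1
  · funext k
    rw [pow_add]
    ring
  · rw [div_pow, mul_pow]
    field_simp
    ring

lemma summable_gaussTrace {X w : 𝕜} (hw : ‖w‖ < 1) : Summable fun p : ℕ × ℕ =>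
    X ^ p.1 / p.1.factorial * (p.2 + p.1).choose p.1 * w ^ (p.2 + p.1) := by
  refine Summable.of_norm ?_
  have hw' : ‖‖w‖‖ < 1 := by simpa using hw
  have h1 : ∀ j : ℕ, HasSum
      (fun k : ℕ => ‖X ^ j / j.factorial * (k + j).choose j * w ^ (k + j)‖)
      ((‖X‖ * ‖w‖ / (1 - ‖w‖)) ^ j / j.factorial * (1 - ‖w‖)⁻¹) := fun j =>
    (gaussTrace_aux (X := ‖X‖) hw' j).congr_fun fun k => by simp
  refine (summable_prod_of_nonneg fun p => norm_nonneg _).2 ⟨fun j => (h1 j).summable, ?_⟩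
  have h2 : Summable fun j : ℕ =>
      (‖X‖ * ‖w‖ / (1 - ‖w‖)) ^ j / j.factorial * (1 - ‖w‖)⁻¹ :=
    (Real.summable_pow_div_factorial _).mul_right _
  exact h2.congr fun j => (h1 j).tsum_eq.symm

lemma hasSum_gaussEntry_diag (c d : 𝕜) {w : 𝕜} (hw : ‖w‖ < 1) :
    HasSum (fun a : ℕ => gaussEntry c d a a * w ^ a)
      (NormedSpace.exp (c * d * w / (1 - w)) * (1 - w)⁻¹) := by
  have hs := (summable_gaussTrace (X := c * d) hw).hasSum
  have h1 := hs.prod_fiberwise fun j => gaussTrace_aux hw j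
  have h0 : HasSum (fun j : ℕ => (c * d * w / (1 - w)) ^ j / (j.factorial : 𝕜))
    (NormedSpace.exp (c * d * w / (1 - w))) := NormedSpace.expSeries_div_hasSum_exp _
  rw [h1.unique (h0.mul_right _)] at hs
  have h2 := (Equiv.hasSum_iff (Finset.HasAntidiagonal.sigmaAntidiagonalEquivProd.trans
    (Equiv.prodComm ℕ ℕ))).2 hs
  refine (h2.sigma fun a => hasSum_fintype _).congr_fun fun a => ?_
  rw [gaussEntry_diag, sum_mul, ← sum_coe_sort]
  refine sum_congr rfl fun p _ => ?_
  have := mem_antidiagonal.1 p.2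
  simp [this]

end Oscillator

/-! ### Sums over occupation numbers -/

section Occupation

variable {M : Type*}

/-- Occupation numbers supported in `insert m T` split off the one of `m`. -/
def occupationInsertEquiv [DecidableEq M] {m : M} {T : Finset M} (hm : m ∉ T) :
    ℕ × {u : M →₀ ℕ // u.support ⊆ T} ≃ {u : M →₀ ℕ // u.support ⊆ insert m T} where
  toFun p := ⟨p.2.1.update m p.1, (Finsupp.support_update_subset p.2.1 m).trans
    (insert_subset_insert m p.2.2)⟩
  invFun u := (u.1 m, ⟨u.1.erase m, by
    rw [Finsupp.support_erase]
    exact subset_insert_iff.1 u.2⟩)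
  left_inv p := by
    refine Prod.ext (by simp) (Subtype.ext ?_)
    simp only [Finsupp.erase_update_eq_erase]
    exact Finsupp.erase_of_notMem_support fun h => hm (p.2.2 h)
  right_inv u := by
    refine Subtype.ext ?_
    simp only [Finsupp.update_erase_eq_update, Finsupp.update_self]

/-- Finitely many oscillators: induction on `T` by the product formula for absolutely convergent
series. -/
lemma hasSum_prod_occupation {𝕜 : Type*} [RCLike 𝕜] (f : M → ℕ → 𝕜)
    (hf : ∀ m, Summable fun a => ‖f m a‖) (T : Finset M) :
    (Summable fun u : {u : M →₀ ℕ // u.support ⊆ T} => ‖∏ m ∈ T, f m (u.1 m)‖) ∧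
    HasSum (fun u : {u : M →₀ ℕ // u.support ⊆ T} => ∏ m ∈ T, f m (u.1 m))
      (∏ m ∈ T, ∑' a, f m a) := by
  classical
  induction T using Finset.induction_on with
  | empty =>
    have : Unique {u : M →₀ ℕ // u.support ⊆ (∅ : Finset M)} :=
      { default := ⟨0, by simp⟩
        uniq := fun u => Subtype.ext (by simpa using u.2) }
    refine ⟨(hasSum_fintype _).summable, ?_⟩
    simp
  | insert m T hm ih =>
    have e : ∀ p : ℕ × {u : M →₀ ℕ // u.support ⊆ T},
        ∏ k ∈ insert m T, f k ((occupationInsertEquiv hm p).1 k)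
          = f m p.1 * ∏ k ∈ T, f k (p.2.1 k) := by
      intro p
      rw [prod_insert hm]
      congr 1
      · simp [occupationInsertEquiv]
      · refine prod_congr rfl fun k hk => ?_
        have : k ≠ m := fun h => hm (h ▸ hk)
        simp [occupationInsertEquiv, this]
    have hs : Summable fun p : ℕ × {u : M →₀ ℕ // u.support ⊆ T} =>
        ‖f m p.1 * ∏ k ∈ T, f k (p.2.1 k)‖ :=
      Summable.mul_norm (f := f m)
        (g := fun u : {u : M →₀ ℕ // u.support ⊆ T} => ∏ k ∈ T, f k (u.1 k)) (hf m) ih.1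
    rw [← (occupationInsertEquiv hm).summable_iff, ← (occupationInsertEquiv hm).hasSum_iff,
      prod_insert hm]
    constructor
    · exact hs.congr fun p => by rw [Function.comp_apply, e]
    · have h := HasSum.mul (f := f m)
        (g := fun u : {u : M →₀ ℕ // u.support ⊆ T} => ∏ k ∈ T, f k (u.1 k))
        (hf m).of_norm.hasSum ih.2 (Summable.of_norm hs)
      exact h.congr_fun fun p => by rw [Function.comp_apply, e]

/-- A sum over all occupation numbers of a product over the oscillators is the product of the
sums over the single oscillators. -/
lemma hasProd_tsum_occupation {f : M → ℕ → ℂ} {F : (M →₀ ℕ) → ℂ} (S : Finset M)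
    (hF : ∀ T, S ⊆ T → ∀ u : M →₀ ℕ, u.support ⊆ T → F u = ∏ m ∈ T, f m (u m))
    (hf : ∀ m, Summable fun a => ‖f m a‖) {K : ℝ}
    (hK : ∀ T, S ⊆ T → ∏ m ∈ T, ∑' a, ‖f m a‖ ≤ K) :
    (Summable fun u => ‖F u‖) ∧ HasProd (fun m => ∑' a, f m a) (∑' u, F u) := by
  classical
  have hsum : Summable fun u => ‖F u‖ := by
    -- Finitely many states excite only finitely many oscillators, so a finite partial sum is
    -- bounded by a product over a finite `T`, hence by the uniform bound `K`.
    refine summable_of_sum_le (c := K) (fun u => norm_nonneg _) fun U => ?_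
    set T : Finset M := S ∪ U.biUnion Finsupp.support
    have hT : S ⊆ T := subset_union_left
    have hU : ∀ u ∈ U, u.support ⊆ T := fun u hu =>
      (subset_biUnion_of_mem Finsupp.support hu).trans subset_union_right
    have h := hasSum_prod_occupation (fun m a => ‖f m a‖)
      (fun m => (hf m).congr fun a => (norm_norm _).symm) T
    refine le_trans ?_ (hK T hT)
    rw [← h.2.tsum_eq]
    have h1 := h.2.summable.sum_le_tsum (U.attach.map
      ⟨fun u => (⟨u.1, hU u.1 u.2⟩ : {u : M →₀ ℕ // u.support ⊆ T}),
        fun a b hab => Subtype.ext (by simpa using hab)⟩)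
      (fun u _ => prod_nonneg fun m _ => norm_nonneg _)
    refine le_trans (le_of_eq ?_) h1
    rw [sum_map, ← sum_attach]
    refine sum_congr rfl fun u _ => ?_
    rw [hF T hT u.1 (hU u.1 u.2), norm_prod]
    rfl
  refine ⟨hsum, ?_⟩
  -- Dominated convergence as `T` exhausts the oscillators: each state is eventually supported in
  -- `T`.
  have hlim : Filter.Tendsto
      (fun T : Finset M => ∑' u, {u : M →₀ ℕ | u.support ⊆ T}.indicator F u)
      Filter.atTop (nhds (∑' u, F u)) := by
    refine tendsto_tsum_of_dominated_convergence hsum (fun u => ?_)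
      (Filter.Eventually.of_forall fun T u => norm_indicator_le_norm_self _ _)
    refine tendsto_const_nhds.congr' ?_
    filter_upwards [Filter.eventually_ge_atTop u.support] with T hT
    rw [Set.indicator_of_mem (show u ∈ {u : M →₀ ℕ | u.support ⊆ T} from hT)]
  refine hlim.congr' ?_
  filter_upwards [Filter.eventually_ge_atTop S] with T hT
  rw [← (hasSum_prod_occupation f hf T).2.tsum_eq, ← _root_.tsum_subtype]
  exact tsum_congr fun u => hF T hT u.1 u.2

open Classical in
/-- The matrix of `e^{∑ C_m x_m} e^{∑ D_m ∂_m}` in the monomial basis. -/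
def gaussKernel (C D : M → ℂ) (α β : M →₀ ℕ) : ℂ :=
  ∏ m ∈ α.support ∪ β.support, gaussEntry (C m) (D m) (α m) (β m)

lemma gaussKernel_eq_prod (C D : M → ℂ) {α β : M →₀ ℕ} {T : Finset M}
    (hα : α.support ⊆ T) (hβ : β.support ⊆ T) :
    gaussKernel C D α β = ∏ m ∈ T, gaussEntry (C m) (D m) (α m) (β m) := by
  classical
  refine prod_subset (union_subset hα hβ) fun m _ hm => ?_
  simp only [mem_union, Finsupp.mem_support_iff, not_or, not_not] at hm
  rw [hm.1, hm.2, gaussEntry_zero_zero]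

/-- The one-oscillator composition law in each variable. Off the finite set of oscillators excited
in `α` or `β`, the factor is just `e^{d_m C_m}`, so summability of `d_m C_m` controls the infinite
product. -/
lemma hasSum_gaussKernel_mul_gaussKernel {c d C D : M → ℂ}
    (h : Summable fun m => d m * C m) (α β : M →₀ ℕ) :
    HasSum (fun u => gaussKernel c d α u * gaussKernel C D u β)
      (Complex.exp (∑' m, d m * C m) * gaussKernel (c + C) (d + D) α β) := by
  classical
  set S := α.support ∪ β.support
  have hSα : ∀ {T}, S ⊆ T → α.support ⊆ T := fun h => subset_union_left.trans h
  have hSβ : ∀ {T}, S ⊆ T → β.support ⊆ T := fun h => subset_union_right.trans h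
  have hS : ∀ m ∉ S, α m = 0 ∧ β m = 0 := fun m hm => by
    simpa only [S, mem_union, Finsupp.mem_support_iff, not_or, not_not] using hm
  -- The majorant of `‖f m a‖` is the same expression with norms as coefficients, summed by the
  -- composition law over ℝ.
  set f : M → ℕ → ℂ := fun m a =>
    gaussEntry (c m) (d m) (α m) a * gaussEntry (C m) (D m) a (β m) with hfdef
  have hR : ∀ m, HasSum (fun a => gaussEntry ‖c m‖ ‖d m‖ (α m) a
      * gaussEntry ‖C m‖ ‖D m‖ a (β m)) (Real.exp ‖d m * C m‖
        * gaussEntry (‖c m‖ + ‖C m‖) (‖d m‖ + ‖D m‖) (α m) (β m)) := fun m => by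
    rw [norm_mul, Real.exp_eq_exp_ℝ]
    exact hasSum_gaussEntry_mul_gaussEntry _ _ _ _ _ _
  have hle : ∀ m a, ‖f m a‖ ≤ gaussEntry ‖c m‖ ‖d m‖ (α m) a
      * gaussEntry ‖C m‖ ‖D m‖ a (β m) := fun m a => by
    rw [hfdef, norm_mul]
    exact mul_le_mul (norm_gaussEntry_le _ _ _ _) (norm_gaussEntry_le _ _ _ _) (norm_nonneg _)
      ((norm_nonneg (gaussEntry (c m) (d m) (α m) a)).trans (norm_gaussEntry_le _ _ _ _))
  have hf : ∀ m, Summable fun a => ‖f m a‖ := fun m =>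
    Summable.of_nonneg_of_le (fun _ => norm_nonneg _) (hle m) (hR m).summable
  have hK : ∀ T, S ⊆ T → ∏ m ∈ T, ∑' a, ‖f m a‖ ≤ Real.exp (∑' m, ‖d m * C m‖)
      * ∏ m ∈ S, gaussEntry (‖c m‖ + ‖C m‖) (‖d m‖ + ‖D m‖) (α m) (β m) := by
    intro T hT
    have e : ∏ m ∈ S, gaussEntry (‖c m‖ + ‖C m‖) (‖d m‖ + ‖D m‖) (α m) (β m)
        = ∏ m ∈ T, gaussEntry (‖c m‖ + ‖C m‖) (‖d m‖ + ‖D m‖) (α m) (β m) :=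
      prod_subset hT fun m _ hm => by rw [(hS m hm).1, (hS m hm).2, gaussEntry_zero_zero]
    have hnn : ∀ m, 0 ≤ gaussEntry (‖c m‖ + ‖C m‖) (‖d m‖ + ‖D m‖) (α m) (β m) := fun m => by
      refine (norm_nonneg _).trans ((norm_gaussEntry_le
        (‖c m‖ + ‖C m‖) (‖d m‖ + ‖D m‖) (α m) (β m)).trans (le_of_eq ?_))
      rw [Real.norm_of_nonneg (by positivity), Real.norm_of_nonneg (by positivity)]
    calc ∏ m ∈ T, ∑' a, ‖f m a‖
        ≤ ∏ m ∈ T, (Real.exp ‖d m * C m‖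
          * gaussEntry (‖c m‖ + ‖C m‖) (‖d m‖ + ‖D m‖) (α m) (β m)) :=
          prod_le_prod (fun m _ => tsum_nonneg fun a => norm_nonneg _) fun m _ =>
            ((hf m).tsum_le_tsum (hle m) (hR m).summable).trans (le_of_eq (hR m).tsum_eq)
      _ ≤ _ := by
          rw [prod_mul_distrib, ← Real.exp_sum, e]
          exact mul_le_mul_of_nonneg_right (Real.exp_le_exp.2
            (h.norm.sum_le_tsum T fun m _ => norm_nonneg _)) (prod_nonneg fun m _ => hnn m)
  obtain ⟨h1, h2⟩ := hasProd_tsum_occupation (f := f)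
    (F := fun u => gaussKernel c d α u * gaussKernel C D u β) S (fun T hT u hu => by
      rw [gaussKernel_eq_prod c d (hSα hT) hu, gaussKernel_eq_prod C D hu (hSβ hT),
        ← prod_mul_distrib]) hf hK
  have h3 : HasProd (fun m => Complex.exp (d m * C m)
      * gaussEntry (c m + C m) (d m + D m) (α m) (β m))
      (Complex.exp (∑' m, d m * C m) * gaussKernel (c + C) (d + D) α β) := by
    refine h.hasSum.cexp.mul ?_
    exact hasProd_prod_of_ne_finset_one fun m hm => by
      rw [(hS m hm).1, (hS m hm).2, gaussEntry_zero_zero]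
  have h4 : (fun m => ∑' a, f m a) = fun m => Complex.exp (d m * C m)
      * gaussEntry (c m + C m) (d m + D m) (α m) (β m) := funext fun m => by
    rw [Complex.exp_eq_exp_ℂ]
    exact (hasSum_gaussEntry_mul_gaussEntry _ _ _ _ _ _).tsum_eq
  rw [h4] at h2
  rw [h3.unique h2]
  exact h1.of_norm.hasSum

/-- Turns the products of geometric sums into exponentials of a convergent series, giving a bound
uniform in the finite set of oscillators. -/
lemma one_sub_inv_le_exp {r : ℝ} (h : r < 1) : (1 - r)⁻¹ ≤ Real.exp (r / (1 - r)) := by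
  have h1 : (1 - r) ≠ 0 := by linarith
  have : (1 - r)⁻¹ = r / (1 - r) + 1 := by field_simp; ring
  rw [this]
  exact Real.add_one_le_exp _

/-- The trace of `e^{∑ C_m x_m} e^{∑ D_m ∂_m} ∏ w_m^{x_m ∂_m}`. -/
lemma hasSum_gaussKernel_diag {C D w : M → ℂ} (hw : ∀ m, ‖w m‖ < 1)
    (h1 : Summable fun m => ‖w m‖ / (1 - ‖w m‖))
    (h2 : Summable fun m => ‖C m * D m‖ * ‖w m‖ / (1 - ‖w m‖)) :
    HasSum (fun u : M →₀ ℕ => gaussKernel C D u u * u.prod fun m a => w m ^ a)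
      (Complex.exp (∑' m, C m * D m * w m / (1 - w m) - ∑' m, Complex.log (1 - w m))) := by
  have hw1 : ∀ m, 0 < 1 - ‖w m‖ := fun m => sub_pos.2 (hw m)
  have hw1' : ∀ m, 1 - ‖w m‖ ≤ ‖1 - w m‖ := fun m => by
    simpa using norm_sub_norm_le 1 (w m)
  have hw0 : ∀ m, 1 - w m ≠ 0 := fun m h => by
    have := (hw1 m).trans_le (hw1' m)
    simp [h] at this
  have hR : ∀ m, HasSum (fun a => gaussEntry ‖C m‖ ‖D m‖ a a * ‖w m‖ ^ a)
      (Real.exp (‖C m * D m‖ * ‖w m‖ / (1 - ‖w m‖)) * (1 - ‖w m‖)⁻¹) := fun m => by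
    rw [norm_mul, Real.exp_eq_exp_ℝ]
    exact hasSum_gaussEntry_diag _ _ (by simpa using hw m)
  set f : M → ℕ → ℂ := fun m a => gaussEntry (C m) (D m) a a * w m ^ a with hfdef
  have hle : ∀ m a, ‖f m a‖ ≤ gaussEntry ‖C m‖ ‖D m‖ a a * ‖w m‖ ^ a := fun m a => by
    rw [hfdef, norm_mul, norm_pow]
    exact mul_le_mul_of_nonneg_right (norm_gaussEntry_le _ _ _ _) (by positivity)
  have hf : ∀ m, Summable fun a => ‖f m a‖ := fun m =>
    Summable.of_nonneg_of_le (fun _ => norm_nonneg _) (hle m) (hR m).summable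
  have hnn : ∀ m, 0 ≤ ‖w m‖ / (1 - ‖w m‖) := fun m => div_nonneg (norm_nonneg _) (hw1 m).le
  have hnn' : ∀ m, 0 ≤ ‖C m * D m‖ * ‖w m‖ / (1 - ‖w m‖) := fun m =>
    div_nonneg (by positivity) (hw1 m).le
  have hK : ∀ T : Finset M, ∅ ⊆ T → ∏ m ∈ T, ∑' a, ‖f m a‖
      ≤ Real.exp (∑' m, (‖C m * D m‖ * ‖w m‖ / (1 - ‖w m‖) + ‖w m‖ / (1 - ‖w m‖))) := by
    intro T _
    calc ∏ m ∈ T, ∑' a, ‖f m a‖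
        ≤ ∏ m ∈ T, Real.exp (‖C m * D m‖ * ‖w m‖ / (1 - ‖w m‖) + ‖w m‖ / (1 - ‖w m‖)) := by
          refine prod_le_prod (fun m _ => tsum_nonneg fun a => norm_nonneg _) fun m _ => ?_
          refine ((hf m).tsum_le_tsum (hle m) (hR m).summable).trans ?_
          rw [(hR m).tsum_eq, Real.exp_add]
          exact mul_le_mul_of_nonneg_left (one_sub_inv_le_exp (hw m)) (Real.exp_pos _).le
      _ ≤ _ := by
          rw [← Real.exp_sum]
          exact Real.exp_le_exp.2 ((h2.add h1).sum_le_tsum T fun m _ =>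
            add_nonneg (hnn' m) (hnn m))
  obtain ⟨hs, hp⟩ := hasProd_tsum_occupation (f := f)
    (F := fun u : M →₀ ℕ => gaussKernel C D u u * u.prod fun m a => w m ^ a) ∅
    (fun T hT u hu => by
      rw [gaussKernel_eq_prod C D hu hu, Finsupp.prod_of_support_subset u hu _ (by simp),
        ← prod_mul_distrib]) hf hK
  have hA : Summable fun m => C m * D m * w m / (1 - w m) := by
    refine Summable.of_norm_bounded h2 fun m => ?_
    rw [norm_div, norm_mul]
    exact div_le_div_of_nonneg_left (by positivity) (hw1 m) (hw1' m)
  have hB : Summable fun m => Complex.log (1 - w m) := by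
    have : Summable fun m => -w m := by
      refine (Summable.of_norm_bounded h1 fun m => ?_).neg
      rw [le_div_iff₀ (hw1 m)]
      nlinarith [norm_nonneg (w m)]
    simpa [sub_eq_add_neg] using Complex.summable_log_one_add_of_summable this
  have h3 := (hA.hasSum.sub hB.hasSum).cexp
  have h4 : (fun m => ∑' a, f m a)
      = Complex.exp ∘ fun m => C m * D m * w m / (1 - w m) - Complex.log (1 - w m) := by
    funext m
    rw [Function.comp_apply, Complex.exp_sub, Complex.exp_log (hw0 m), div_eq_mul_inv,
      Complex.exp_eq_exp_ℂ]
    exact (hasSum_gaussEntry_diag _ _ (hw m)).tsum_eq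
  rw [h4] at hp
  rw [h3.unique hp]
  exact hs.of_norm.hasSum

end Occupation

/-! ### The Jacobi triple product -/

section TripleProduct

lemma expTwoPiI_add (x y : ℂ) : expTwoPiI (x + y) = expTwoPiI x * expTwoPiI y := by
  rw [expTwoPiI, mul_add, Complex.exp_add]; rfl

lemma expTwoPiI_neg (x : ℂ) : expTwoPiI (-x) = (expTwoPiI x)⁻¹ := by
  rw [expTwoPiI, mul_neg, Complex.exp_neg]; rfl

lemma expTwoPiI_sub (x y : ℂ) : expTwoPiI (x - y) = expTwoPiI x / expTwoPiI y := by
  rw [sub_eq_add_neg, expTwoPiI_add, expTwoPiI_neg, div_eq_mul_inv]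

lemma expTwoPiI_nat_mul (n : ℕ) (x : ℂ) : expTwoPiI (n * x) = expTwoPiI x ^ n := by
  rw [expTwoPiI, mul_left_comm, Complex.exp_nat_mul]; rfl

lemma expTwoPiI_ne_zero (x : ℂ) : expTwoPiI x ≠ 0 := Complex.exp_ne_zero _

lemma expTwoPiI_half : expTwoPiI (1 / 2) = -1 := by
  rw [expTwoPiI, ← Complex.exp_pi_mul_I]
  congr 1
  ring

lemma norm_expTwoPiI_lt_one {τ : ℂ} (hτ : 0 < τ.im) : ‖expTwoPiI τ‖ < 1 := by
  rw [expTwoPiI, Complex.norm_exp, Real.exp_lt_one_iff]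
  simp
  positivity

/-! ### Infinite `q`-products, their logarithms, and the passage from finite to infinite triple
product. -/

variable {a q : ℂ}

lemma summable_mul_pow (a : ℂ) (hq : ‖q‖ < 1) : Summable fun n : ℕ => a * q ^ n :=
  (summable_geometric_of_norm_lt_one hq).mul_left a

lemma summable_log_qPochhammer (a : ℂ) (hq : ‖q‖ < 1) :
    Summable fun n : ℕ => Complex.log (1 - a * q ^ n) := by
  simpa [sub_eq_add_neg] using
    Complex.summable_log_one_add_of_summable (summable_mul_pow a hq).neg

lemma tendsto_qPochhammer (a : ℂ) (hq : ‖q‖ < 1) :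
    Filter.Tendsto (fun N => ∏ n ∈ range N, (1 - a * q ^ n)) Filter.atTop
      (nhds (qPochhammer a q)) := by
  have h : Multipliable fun n : ℕ => (1 + -(a * q ^ n)) :=
    multipliable_one_add_of_summable (summable_mul_pow a hq).neg.norm
  simpa only [sub_eq_add_neg, qPochhammer] using h.hasProd.tendsto_prod_nat

lemma exp_logQPochhammer (hq : ‖q‖ < 1) (h : ∀ n : ℕ, 1 - a * q ^ n ≠ 0) :
    Complex.exp (logQPochhammer a q) = qPochhammer a q :=
  Complex.cexp_tsum_eq_tprod h (summable_log_qPochhammer a hq)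

lemma one_sub_mul_pow_ne_zero (ha : ‖a‖ < 1) (hq : ‖q‖ < 1) (n : ℕ) : 1 - a * q ^ n ≠ 0 := by
  intro h
  have h1 : ‖a * q ^ n‖ < 1 := by
    rw [norm_mul, norm_pow]
    exact (mul_le_of_le_one_right (norm_nonneg a) (pow_le_one₀ (norm_nonneg q) hq.le)).trans_lt ha
  rw [← sub_eq_zero.1 h] at h1
  simp at h1

lemma qPochhammer_ne_zero (ha : ‖a‖ < 1) (hq : ‖q‖ < 1) : qPochhammer a q ≠ 0 := by
  rw [← exp_logQPochhammer hq (one_sub_mul_pow_ne_zero ha hq)]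
  exact Complex.exp_ne_zero _

/-- The finite product `(q;q)_k`. -/
def qFactorialProd (q : ℂ) (k : ℕ) : ℂ := ∏ n ∈ range k, (1 - q * q ^ n)

lemma qFactorialProd_ne_zero (hq : ‖q‖ < 1) (k : ℕ) : qFactorialProd q k ≠ 0 :=
  prod_ne_zero_iff.2 fun n _ => one_sub_mul_pow_ne_zero hq hq n

lemma qFactorialProd_succ (q : ℂ) (k : ℕ) :
    qFactorialProd q (k + 1) = qFactorialProd q k * (1 - q * q ^ k) := prod_range_succ _ _

/-- The Gaussian binomial coefficient. -/
def qBinomial (q : ℂ) (M j : ℕ) : ℂ :=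
  if j ≤ M then qFactorialProd q M / (qFactorialProd q j * qFactorialProd q (M - j)) else 0

lemma qBinomial_zero_right (hq : ‖q‖ < 1) (M : ℕ) : qBinomial q M 0 = 1 := by
  have := qFactorialProd_ne_zero hq M
  simp [qBinomial, this, show qFactorialProd q 0 = 1 from prod_range_zero _]

lemma qBinomial_succ_succ (hq : ‖q‖ < 1) {M j : ℕ} (hj : j ≤ M) :
    qBinomial q (M + 1) (j + 1) = qBinomial q M (j + 1) + q ^ (M - j) * qBinomial q M j := by
  have h0 : qFactorialProd q 0 = 1 := prod_range_zero _
  -- For `j = M` the first term on the right is the default value 0 beyond the range.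
  rcases hj.eq_or_lt with rfl | h
  · have := qFactorialProd_ne_zero hq j
    have h2 := qFactorialProd_ne_zero hq (j + 1)
    simp [qBinomial, h0, this, h2]
  · obtain ⟨k, rfl⟩ := Nat.exists_eq_add_of_lt h
    have h1 := qFactorialProd_ne_zero hq j
    have h2 := qFactorialProd_ne_zero hq k
    have h3 := one_sub_mul_pow_ne_zero hq hq j
    have h4 := one_sub_mul_pow_ne_zero hq hq k
    rw [qBinomial, qBinomial, qBinomial, if_pos (by omega), if_pos (by omega), if_pos (by omega),
      show j + k + 1 + 1 - (j + 1) = k + 1 by omega, show j + k + 1 - (j + 1) = k by omega,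
      show j + k + 1 - j = k + 1 by omega, qFactorialProd_succ q (j + k + 1),
      qFactorialProd_succ q k, qFactorialProd_succ q j]
    field_simp
    ring

/-- The `q`-binomial theorem. -/
lemma prod_one_add_mul_pow (hq : ‖q‖ < 1) (x : ℂ) (M : ℕ) :
    ∏ k ∈ range M, (1 + x * q ^ k)
      = ∑ j ∈ range (M + 1), qBinomial q M j * q ^ j.choose 2 * x ^ j := by
  induction M with
  | zero => simp [qBinomial_zero_right hq]
  | succ M ih =>
    rw [prod_range_succ, ih, sum_range_succ' _ (M + 1), qBinomial_zero_right hq]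
    have e : ∀ j ∈ range (M + 1), qBinomial q (M + 1) (j + 1) * q ^ (j + 1).choose 2 * x ^ (j + 1)
        = qBinomial q M (j + 1) * q ^ (j + 1).choose 2 * x ^ (j + 1)
          + x * q ^ M * (qBinomial q M j * q ^ j.choose 2 * x ^ j) := fun j hj => by
      have hj' : j ≤ M := by simp at hj; omega
      have h1 : q ^ M = q ^ (M - j) * q ^ j := by rw [← pow_add, Nat.sub_add_cancel hj']
      rw [qBinomial_succ_succ hq hj', h1, Nat.choose_succ_succ' j 1, Nat.choose_one_right, pow_add]
      ring
    have h2 := sum_range_succ' (fun j => qBinomial q M j * q ^ j.choose 2 * x ^ j) (M + 1)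
    rw [sum_range_succ, show qBinomial q M (M + 1) = 0 from if_neg (by omega),
      qBinomial_zero_right hq] at h2
    rw [sum_congr rfl e, sum_add_distrib, ← mul_sum]
    linear_combination h2

/-- The finite form of the Jacobi triple product. -/
lemma finite_tripleProduct (x : ℂ) {τ : ℂ} (hτ : 0 < τ.im) (N : ℕ) :
    (∏ k ∈ range N, (1 - (expTwoPiI x)⁻¹ * expTwoPiI τ ^ k))
        * ∏ k ∈ range N, (1 - expTwoPiI τ * expTwoPiI x * expTwoPiI τ ^ k)
      = ∑ j ∈ range (2 * N + 1), qBinomial (expTwoPiI τ) (2 * N) j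
          * jacobiTheta₂_term ((j : ℤ) - N) (x + 1 / 2 + τ / 2) τ := by
  set q := expTwoPiI τ with hq
  set z := expTwoPiI x with hz
  have hq0 : q ≠ 0 := expTwoPiI_ne_zero _
  have hz0 : z ≠ 0 := expTwoPiI_ne_zero _
  -- The `q`-binomial theorem at `-z q^{1-N}` with `2N` factors, so that the exponents of `q` run
  -- symmetrically over `1-N, …, N`.
  have h := prod_one_add_mul_pow (norm_expTwoPiI_lt_one hτ)
    (expTwoPiI (x + 1 / 2 + (1 - N) * τ)) (2 * N)
  have hx : expTwoPiI (x + 1 / 2 + (1 - N) * τ) = -z * q / q ^ N := by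
    rw [show x + 1 / 2 + (1 - N) * τ = x + 1 / 2 + τ - N * τ by ring, expTwoPiI_sub,
      expTwoPiI_add, expTwoPiI_add, expTwoPiI_half, expTwoPiI_nat_mul]
    ring
  -- The lower half is inverted factor by factor: `1 - z q^{-j} = (-z q^{-j})(1 - z⁻¹ q^j)`, with `j
  -- = N-1-k`.
  have h1 : ∏ k ∈ range N, (1 + -z * q / q ^ N * q ^ k)
      = (-z) ^ N * (q ^ N.choose 2)⁻¹ * ∏ k ∈ range N, (1 - z⁻¹ * q ^ k) := by
    rw [← prod_range_reflect, Nat.choose_two_right, ← sum_range_id, ← prod_pow_eq_pow_sum,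
      ← prod_inv_distrib, show (-z) ^ N = ∏ _k ∈ range N, (-z) by simp, ← prod_mul_distrib,
      ← prod_mul_distrib]
    refine prod_congr rfl fun k hk => ?_
    have hN : q ^ N = q ^ (N - 1 - k) * q * q ^ k := by
      rw [← pow_succ, ← pow_add]
      congr 1
      simp at hk
      omega
    rw [hN]
    field_simp
    ring
  have h2 : ∏ k ∈ range N, (1 + -z * q / q ^ N * q ^ (N + k))
      = ∏ k ∈ range N, (1 - q * z * q ^ k) := by
    refine prod_congr rfl fun k _ => ?_
    rw [pow_add]
    field_simp
    ring
  rw [two_mul, prod_range_add, ← two_mul, hx, h1, h2, ← hx] at h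
  have h3 : (-z) ^ N * (q ^ N.choose 2)⁻¹ ≠ 0 :=
    mul_ne_zero (pow_ne_zero _ (neg_ne_zero.2 hz0)) (inv_ne_zero (pow_ne_zero _ hq0))
  have hnz : (-z) ^ N * (q ^ N.choose 2)⁻¹
      = expTwoPiI (N * (x + 1 / 2) - (N.choose 2 : ℕ) * τ) := by
    rw [expTwoPiI_sub, expTwoPiI_nat_mul, expTwoPiI_nat_mul, expTwoPiI_add, expTwoPiI_half,
      div_eq_mul_inv]
    ring
  refine mul_left_cancel₀ h3 ?_
  rw [← mul_assoc, h, mul_sum]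
  refine sum_congr rfl fun j _ => ?_
  rw [hnz, mul_left_comm, mul_assoc, ← expTwoPiI_nat_mul, hq, ← expTwoPiI_nat_mul]
  congr 1
  rw [← expTwoPiI_add, expTwoPiI, expTwoPiI, jacobiTheta₂_term, ← Complex.exp_add,
    Nat.cast_choose_two, Nat.cast_choose_two]
  congr 1
  push_cast
  ring

/-- The coefficients of the finite triple product, indexed symmetrically. -/
def centeredQBinomial (q : ℂ) (N : ℕ) (n : ℤ) : ℂ :=
  if -(N : ℤ) ≤ n then qBinomial q (2 * N) (n + N).toNat else 0

lemma tendsto_qFactorialProd (hq : ‖q‖ < 1) :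
    Filter.Tendsto (qFactorialProd q) Filter.atTop (nhds (qPochhammer q q)) :=
  tendsto_qPochhammer q hq

lemma tendsto_centeredQBinomial (hq : ‖q‖ < 1) (n : ℤ) :
    Filter.Tendsto (fun N => centeredQBinomial q N n) Filter.atTop
      (nhds (qPochhammer q q)⁻¹) := by
  have h0 := qPochhammer_ne_zero hq hq
  have h := tendsto_qFactorialProd hq
  have h1 : Filter.Tendsto (fun N : ℕ => 2 * N) Filter.atTop Filter.atTop :=
    Filter.tendsto_atTop_mono (fun N => by simp only [id]; omega) Filter.tendsto_id
  have h2 : Filter.Tendsto (fun N : ℕ => (n + N).toNat) Filter.atTop Filter.atTop :=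
    Filter.tendsto_atTop.2 fun b => by
      filter_upwards [Filter.eventually_ge_atTop (b + n.natAbs)] with N hN
      omega
  have h3 : Filter.Tendsto (fun N : ℕ => 2 * N - (n + N).toNat) Filter.atTop Filter.atTop :=
    Filter.tendsto_atTop.2 fun b => by
      filter_upwards [Filter.eventually_ge_atTop (b + n.natAbs)] with N hN
      omega
  have h4 := (h.comp h1).div ((h.comp h2).mul (h.comp h3)) (mul_ne_zero h0 h0)
  rw [show qPochhammer q q / (qPochhammer q q * qPochhammer q q) = (qPochhammer q q)⁻¹ by
    field_simp] at h4
  refine h4.congr' ?_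
  filter_upwards [Filter.eventually_ge_atTop n.natAbs] with N hN
  rw [centeredQBinomial, if_pos (by omega), qBinomial, if_pos (by omega)]
  rfl

/-- The constant for dominated convergence in the triple product: `(q;q)_k` has a nonzero limit, so
it and its inverse are bounded. -/
lemma exists_norm_centeredQBinomial_le (hq : ‖q‖ < 1) :
    ∃ K, ∀ N n, ‖centeredQBinomial q N n‖ ≤ K := by
  obtain ⟨A, hA⟩ := (tendsto_qFactorialProd hq).norm.bddAbove_range
  obtain ⟨B, hB⟩ := ((tendsto_qFactorialProd hq).inv₀ (qPochhammer_ne_zero hq hq)).norm.bddAbove_range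
  have hA' : ∀ k, ‖qFactorialProd q k‖ ≤ A := fun k => hA ⟨k, rfl⟩
  have hB' : ∀ k, ‖(qFactorialProd q k)⁻¹‖ ≤ B := fun k => hB ⟨k, rfl⟩
  have hA0 := (norm_nonneg _).trans (hA' 0)
  have hB0 := (norm_nonneg _).trans (hB' 0)
  refine ⟨A * (B * B), fun N n => ?_⟩
  rw [centeredQBinomial, qBinomial]
  split_ifs
  · rw [div_eq_mul_inv, mul_inv, norm_mul, norm_mul]
    gcongr
    exacts [hA' _, hB' _, hB' _]
  · rw [norm_zero]; positivity
  · rw [norm_zero]; positivity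

/-- The Jacobi triple product. -/
lemma tsum_jacobiTheta₂_term (x : ℂ) {τ : ℂ} (hτ : 0 < τ.im) :
    ∑' n : ℤ, jacobiTheta₂_term n (x + 1 / 2 + τ / 2) τ
      = qPochhammer (expTwoPiI τ) (expTwoPiI τ) * (qPochhammer (expTwoPiI x)⁻¹ (expTwoPiI τ)
        * qPochhammer (expTwoPiI τ * expTwoPiI x) (expTwoPiI τ)) := by
  have hq := norm_expTwoPiI_lt_one hτ
  have hs := (summable_jacobiTheta₂_term_iff (x + 1 / 2 + τ / 2) τ).2 hτ
  obtain ⟨K, hK⟩ := exists_norm_centeredQBinomial_le hq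
  have h1 : Filter.Tendsto (fun N : ℕ => ∑' n : ℤ, centeredQBinomial (expTwoPiI τ) N n
      * jacobiTheta₂_term n (x + 1 / 2 + τ / 2) τ) Filter.atTop
      (nhds (∑' n : ℤ, (qPochhammer (expTwoPiI τ) (expTwoPiI τ))⁻¹
        * jacobiTheta₂_term n (x + 1 / 2 + τ / 2) τ)) := by
    refine tendsto_tsum_of_dominated_convergence (hs.norm.mul_left K)
      (fun n => (tendsto_centeredQBinomial hq n).mul_const _)
      (Filter.Eventually.of_forall fun N n => ?_)
    rw [norm_mul]
    exact mul_le_mul_of_nonneg_right (hK N n) (norm_nonneg _)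
  have h2 := (tendsto_qPochhammer (expTwoPiI x)⁻¹ hq).mul
    (tendsto_qPochhammer (expTwoPiI τ * expTwoPiI x) hq)
  have h3 : ∀ N : ℕ, ∑' n : ℤ, centeredQBinomial (expTwoPiI τ) N n
      * jacobiTheta₂_term n (x + 1 / 2 + τ / 2) τ
      = (∏ k ∈ range N, (1 - (expTwoPiI x)⁻¹ * expTwoPiI τ ^ k))
        * ∏ k ∈ range N, (1 - expTwoPiI τ * expTwoPiI x * expTwoPiI τ ^ k) := by
    intro N
    -- The centered coefficients vanish outside `-N ≤ n ≤ N`, so the sum over ℤ is the finite triple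
    -- product.
    rw [finite_tripleProduct x hτ N, tsum_eq_sum (s := (range (2 * N + 1)).map
      ⟨fun j : ℕ => (j : ℤ) - N, fun a b h => by simpa using h⟩), sum_map]
    · refine sum_congr rfl fun j hj => ?_
      change centeredQBinomial _ N ((j : ℤ) - N) * jacobiTheta₂_term ((j : ℤ) - N) _ _ = _
      rw [centeredQBinomial, if_pos (by omega), show ((j : ℤ) - N + N).toNat = j by omega]
    · intro n hn
      rw [centeredQBinomial]
      split_ifs with h
      · rw [qBinomial, if_neg, zero_mul]
        intro h'
        refine hn (mem_map.2 ⟨(n + N).toNat, by simp; omega, ?_⟩)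
        change (((n + N).toNat : ℕ) : ℤ) - N = n
        omega
      · rw [zero_mul]
  rw [← tendsto_nhds_unique (h1.congr h3) h2, tsum_mul_left,
    mul_inv_cancel_left₀ (qPochhammer_ne_zero hq hq)]

lemma exp_logTheta11 {x τ : ℂ} (hτ : 0 < τ.im) (h1 : ‖(expTwoPiI x)⁻¹‖ < 1)
    (h2 : ‖expTwoPiI τ * expTwoPiI x‖ < 1) :
    Complex.exp (logTheta11 x τ) = theta11 x τ := by
  have hq := norm_expTwoPiI_lt_one hτ
  -- Expanding the square moves `nπiτ` into the argument as the shift by `τ/2`; what does not depend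
  -- on `n` is the elementary part of `logTheta11`.
  have e : ∀ n : ℤ, Complex.exp (((n : ℂ) + 1 / 2) ^ 2 * Real.pi * Complex.I * τ
      + 2 * Real.pi * Complex.I * ((n : ℂ) + 1 / 2) * (x + 1 / 2))
      = Complex.exp (Real.pi * Complex.I / 2 + 2 * Real.pi * Complex.I * τ / 8
        + Real.pi * Complex.I * x) * jacobiTheta₂_term n (x + 1 / 2 + τ / 2) τ := fun n => by
    rw [jacobiTheta₂_term, ← Complex.exp_add]
    congr 1
    ring
  rw [theta11, tsum_congr e, tsum_mul_left, tsum_jacobiTheta₂_term x hτ, logTheta11,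
    Complex.exp_add, Complex.exp_add, Complex.exp_add,
    exp_logQPochhammer hq (one_sub_mul_pow_ne_zero hq hq),
    exp_logQPochhammer hq (one_sub_mul_pow_ne_zero h1 hq),
    exp_logQPochhammer hq (one_sub_mul_pow_ne_zero h2 hq)]
  ring

lemma exp_logIEtaCubed {τ : ℂ} (hτ : 0 < τ.im) :
    Complex.exp (logIEtaCubed τ) = Complex.I * dedekindEta τ ^ 3 := by
  have hq := norm_expTwoPiI_lt_one hτ
  rw [logIEtaCubed, Complex.exp_add, dedekindEta,
    ← exp_logQPochhammer hq (one_sub_mul_pow_ne_zero hq hq),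
    show expTwoPiI (τ / 24) = Complex.exp (2 * Real.pi * Complex.I * (τ / 24)) from rfl,
    ← Complex.exp_add (2 * Real.pi * Complex.I * (τ / 24)), ← Complex.exp_nat_mul, show (Real.pi : ℂ) * Complex.I / 2 = Real.pi / 2 * Complex.I by ring,
    Complex.exp_pi_div_two_mul_I]
  congr 2
  push_cast
  ring

end TripleProduct

/-! ### Operators with Gaussian matrix elements -/

section Gauss

variable {M ι V : Type*}

lemma lowering_zero (k b : ℕ) : lowering (0 : ℂ) k b = if k = b then 1 else 0 := by
  rcases lt_trichotomy k b with h | rfl | h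
  · rw [lowering, zero_pow (by omega), zero_mul, if_neg h.ne]
  · simp [lowering]
  · rw [lowering_of_lt _ h, if_neg h.ne']

lemma gaussEntry_zero_right (c : ℂ) (a b : ℕ) : gaussEntry c 0 a b = raising c a b := by
  rw [gaussEntry_eq_sum_range c 0 b (show a < a + b + 1 by omega)]
  simp only [lowering_zero, mul_ite, mul_one, mul_zero]
  rw [sum_ite_eq' (range (a + b + 1)) b, if_pos (by simp)]

lemma raising_zero (a b : ℕ) : raising (0 : ℂ) a b = if a = b then 1 else 0 := by
  rw [raising, lowering_zero]
  split_ifs with h h' h'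
  · subst h
    have : (b.factorial : ℂ) ≠ 0 := by exact_mod_cast b.factorial_ne_zero
    rw [one_mul, div_self this]
  · exact absurd h.symm h'
  · exact absurd h'.symm h
  · rw [zero_mul]

lemma gaussEntry_zero_left (d : ℂ) (a b : ℕ) : gaussEntry 0 d a b = lowering d a b := by
  rw [gaussEntry]
  simp only [raising_zero, ite_mul, one_mul, zero_mul]
  rw [sum_ite_eq (range (a + 1)) a, if_pos (by simp)]

lemma mul_raising_pred (c : ℂ) {a : ℕ} (ha : a ≠ 0) (b : ℕ) :
    c * raising c (a - 1) b = ((a : ℂ) - b) * raising c a b := by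
  rcases lt_trichotomy a b with h | rfl | h
  · rw [raising_of_lt c h, raising_of_lt c (by omega), mul_zero, mul_zero]
  · rw [raising_of_lt c (by omega), sub_self, mul_zero, zero_mul]
  · obtain ⟨v, rfl⟩ := Nat.exists_eq_add_of_lt h
    rw [show b + v + 1 - 1 = b + v by omega, raising_add, add_assoc, raising_add, pow_succ,
      Nat.factorial_succ]
    have h1 : (v.factorial : ℂ) ≠ 0 := by exact_mod_cast v.factorial_ne_zero
    have h2 : ((v : ℂ) + 1) ≠ 0 := by exact_mod_cast v.succ_ne_zero
    push_cast
    field_simp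
    ring

lemma mul_lowering_succ (d : ℂ) (a b : ℕ) :
    d * (a + 1) * lowering d (a + 1) b = ((b : ℂ) - a) * lowering d a b := by
  rcases lt_trichotomy b a with h | rfl | h
  · rw [lowering_of_lt d h, lowering_of_lt d (by omega), mul_zero, mul_zero]
  · rw [lowering_of_lt d (by omega), sub_self, mul_zero, zero_mul]
  · obtain ⟨v, rfl⟩ := Nat.exists_eq_add_of_lt h
    have h1 : ((a + v + 1).choose (a + 1) : ℂ) * (a + 1)
        = (a + v + 1).choose a * (v + 1) := by
      have := Nat.choose_succ_right_eq (a + v + 1) a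
      rw [show a + v + 1 - a = v + 1 by omega] at this
      exact_mod_cast this
    rw [lowering, lowering, show a + v + 1 - (a + 1) = v by omega,
      show a + v + 1 - a = v + 1 by omega, pow_succ]
    push_cast
    linear_combination d ^ v * d * h1

lemma gaussKernel_raising_eq_zero {c : M → ℂ} {α β : M →₀ ℕ} {m : M} (h : α m < β m) :
    gaussKernel c 0 α β = 0 := by
  classical
  refine prod_eq_zero (i := m) (by simp; omega) ?_
  rw [Pi.zero_apply, gaussEntry_zero_right, raising_of_lt _ h]

lemma gaussKernel_lowering_eq_zero {d : M → ℂ} {α β : M →₀ ℕ} {m : M} (h : β m < α m) :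
    gaussKernel 0 d α β = 0 := by
  classical
  refine prod_eq_zero (i := m) (by simp; omega) ?_
  rw [Pi.zero_apply, gaussEntry_zero_left, lowering_of_lt _ h]

lemma gaussKernel_raising_self (c : M → ℂ) (α : M →₀ ℕ) : gaussKernel c 0 α α = 1 :=
  prod_eq_one fun m _ => by
    rw [Pi.zero_apply, gaussEntry_zero_right]
    simpa using raising_add (c m) (α m) 0

lemma gaussKernel_lowering_self (d : M → ℂ) (α : M →₀ ℕ) : gaussKernel 0 d α α = 1 :=
  prod_eq_one fun m _ => by
    rw [Pi.zero_apply, gaussEntry_zero_left]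
    simp [lowering]

lemma mul_gaussKernel_raising (c : M → ℂ) {α β : M →₀ ℕ} {m : M} (hm : α m ≠ 0) :
    c m * gaussKernel c 0 (α - Finsupp.single m 1) β
      = ((α m : ℂ) - β m) * gaussKernel c 0 α β := by
  classical
  have h1 : m ∈ α.support ∪ β.support := by simp [hm]
  have h2 : (α - Finsupp.single m 1).support ⊆ α.support ∪ β.support := fun k hk => by
    simp only [mem_union, Finsupp.mem_support_iff, Finsupp.coe_tsub, Pi.sub_apply] at hk ⊢
    exact Or.inl fun h => hk (by omega)
  rw [gaussKernel_eq_prod c 0 h2 subset_union_right, gaussKernel, ← mul_prod_erase _ _ h1,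
    ← mul_prod_erase _ _ h1]
  simp only [Pi.zero_apply, gaussEntry_zero_right]
  rw [← mul_assoc, ← mul_assoc, ← mul_raising_pred (c m) hm]
  congr 1
  · simp
  · refine prod_congr rfl fun k hk => ?_
    have : k ≠ m := ne_of_mem_erase hk
    simp [this.symm]

lemma mul_gaussKernel_lowering (d : M → ℂ) {α β : M →₀ ℕ} {m : M} (hm : β m ≠ 0) :
    d m * (α m + 1) * gaussKernel 0 d (α + Finsupp.single m 1) β
      = ((β m : ℂ) - α m) * gaussKernel 0 d α β := by
  classical
  have h1 : m ∈ α.support ∪ β.support := by simp [hm]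
  have h2 : (α + Finsupp.single m 1).support ⊆ α.support ∪ β.support := fun k hk => by
    by_cases hkm : k = m
    · exact hkm ▸ h1
    · simp only [mem_union, Finsupp.mem_support_iff, Finsupp.coe_add, Pi.add_apply] at hk ⊢
      refine Or.inl fun h => hk ?_
      simp [h, Ne.symm hkm]
  rw [gaussKernel_eq_prod 0 d h2 subset_union_right, gaussKernel, ← mul_prod_erase _ _ h1,
    ← mul_prod_erase _ _ h1]
  simp only [Pi.zero_apply, gaussEntry_zero_left]
  rw [← mul_assoc, ← mul_assoc, ← mul_lowering_succ (d m)]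
  congr 1
  · simp
  · refine prod_congr rfl fun k hk => ?_
    have : k ≠ m := ne_of_mem_erase hk
    simp [this.symm]

/-- Euler's identity for homogeneous polynomials: each variable contributes `α m - β m`, and the
total is the difference of degrees. It is the recursion for the terms of the exponential series. A
variable occurring in `β` but not in `α` makes the kernel vanish, so the sum may stop at the support
of `α`. -/
lemma sum_mul_gaussKernel_raising (c : M → ℂ) (α β : M →₀ ℕ) :
    ∑ m ∈ α.support, c m * gaussKernel c 0 (α - Finsupp.single m 1) β
      = ((α.degree : ℂ) - β.degree) * gaussKernel c 0 α β := by
  classical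
  have h1 : ∀ m ∈ α.support ∪ β.support, m ∉ α.support →
      ((α m : ℂ) - β m) * gaussKernel c 0 α β = 0 := fun m hm hm' => by
    have h : α m = 0 := by simpa using hm'
    have hb : β m ≠ 0 := by simpa [h] using hm
    rw [gaussKernel_raising_eq_zero (m := m) (by omega), mul_zero]
  rw [sum_congr rfl fun m hm => mul_gaussKernel_raising c (Finsupp.mem_support_iff.1 hm),
    sum_subset subset_union_left h1, ← sum_mul, sum_sub_distrib]
  congr 2
  · rw [Finsupp.degree_apply, Nat.cast_sum]
    exact (sum_subset subset_union_left fun m _ hm => by simpa using hm).symm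
  · rw [Finsupp.degree_apply, Nat.cast_sum]
    exact (sum_subset subset_union_right fun m _ hm => by simpa using hm).symm

lemma sum_mul_gaussKernel_lowering (d : M → ℂ) (α β : M →₀ ℕ) :
    ∑ m ∈ β.support, d m * (α m + 1) * gaussKernel 0 d (α + Finsupp.single m 1) β
      = ((β.degree : ℂ) - α.degree) * gaussKernel 0 d α β := by
  classical
  have h1 : ∀ m ∈ α.support ∪ β.support, m ∉ β.support →
      ((β m : ℂ) - α m) * gaussKernel 0 d α β = 0 := fun m hm hm' => by
    have h : β m = 0 := by simpa using hm'
    have hb : α m ≠ 0 := by simpa [h] using hm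
    rw [gaussKernel_lowering_eq_zero (m := m) (by omega), mul_zero]
  rw [sum_congr rfl fun m hm => mul_gaussKernel_lowering d (Finsupp.mem_support_iff.1 hm),
    sum_subset subset_union_right h1, ← sum_mul, sum_sub_distrib]
  congr 2
  · rw [Finsupp.degree_apply, Nat.cast_sum]
    exact (sum_subset subset_union_right fun m _ hm => by simpa using hm).symm
  · rw [Finsupp.degree_apply, Nat.cast_sum]
    exact (sum_subset subset_union_left fun m _ hm => by simpa using hm).symm

lemma eq_of_le_of_degree_eq {α β : M →₀ ℕ} (h : ∀ m, β m ≤ α m) (hd : α.degree = β.degree) :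
    α = β := by
  have h1 : α = β + (α - β) := by
    ext m
    simp [h m]
  have h2 : (α - β).degree = 0 := by
    rw [h1, map_add] at hd
    omega
  rw [Finsupp.degree_eq_zero_iff] at h2
  rw [h1, h2, add_zero]

/-- The exponential of an operator from a solution of the recursion for its terms. -/
lemma opExp_eq_tsum {A : FockOp ι V} (E : ℕ → FockOp ι V) (h0 : E 0 = opOne ι V)
    (hE : ∀ k s t, ∑' u, A s u * E k u t = (k + 1) * E (k + 1) s t) (s t : FockState ι V) :
    opExp A s t = ∑' k, E k s t := by
  have h : ∀ k s t, opPow A k s t = k.factorial * E k s t := by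
    intro k
    induction k with
    | zero => intro s t; rw [opPow, h0]; simp
    | succ k ih =>
      intro s t
      simp only [opPow, opMul, ih]
      rw [Nat.factorial_succ, Nat.cast_mul, mul_right_comm, mul_comm (((k + 1 : ℕ) : ℂ) * _),
        Nat.cast_succ, ← hE k s t, ← tsum_mul_left]
      exact tsum_congr fun u => by ring
  refine tsum_congr fun k => ?_
  have : (k.factorial : ℂ) ≠ 0 := by exact_mod_cast k.factorial_ne_zero
  rw [h, mul_div_cancel_left₀ _ this]

open Classical in
/-- The diagonal operator with the given eigenvalues. -/
def diagOp (δ : FockState ι V → ℂ) : FockOp ι V := fun s t => if s = t then δ t else 0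

lemma diagOp_mul_eq_zero (δ : FockState ι V → ℂ) (A : FockOp ι V) (s t u : FockState ι V)
    (hu : u ∉ ({s} : Finset (FockState ι V))) : diagOp δ s u * A u t = 0 := by
  rw [diagOp, if_neg (fun h => hu (by simp [h])), zero_mul]

lemma summable_diagOp_mul (δ : FockState ι V → ℂ) (A : FockOp ι V) (s t : FockState ι V) :
    Summable fun u => diagOp δ s u * A u t :=
  summable_of_ne_finset_zero (diagOp_mul_eq_zero δ A s t)

lemma opMul_diagOp (δ : FockState ι V → ℂ) (A : FockOp ι V) (s t : FockState ι V) :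
    opMul (diagOp δ) A s t = δ s * A s t := by
  rw [opMul, tsum_eq_sum (diagOp_mul_eq_zero δ A s t), sum_singleton, diagOp, if_pos rfl]

lemma opExp_diagOp (δ : FockState ι V → ℂ) :
    opExp (diagOp δ) = diagOp fun s => Complex.exp (δ s) := by
  funext s t
  rw [opExp_eq_tsum (fun k => diagOp fun s => δ s ^ k / k.factorial)]
  · by_cases h : s = t
    · simp only [diagOp, if_pos h]
      rw [Complex.exp_eq_exp_ℂ]
      exact (NormedSpace.expSeries_div_hasSum_exp (δ t)).tsum_eq
    · simp [diagOp, if_neg h]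
  · funext s t
    simp [diagOp, opOne]
  · intro k s t
    have h := opMul_diagOp δ (diagOp fun s => δ s ^ k / k.factorial) s t
    rw [opMul] at h
    rw [h]
    by_cases h : s = t
    · subst h
      have h1 : (k.factorial : ℂ) ≠ 0 := by exact_mod_cast k.factorial_ne_zero
      have h2 : ((k : ℂ) + 1) ≠ 0 := by exact_mod_cast k.succ_ne_zero
      simp only [diagOp, if_true, Nat.factorial_succ, pow_succ]
      push_cast
      field_simp
    · simp [diagOp, if_neg h]

variable [AddCommGroup V]

open Classical in
/-- The operator `e^{∑ C_m x_m} e^{∑ D_m ∂_m}` combined with a shift of the momentum by `h` and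
a factor depending on the momentum. -/
def gaussOp (h : V) (C D : ι × ℕ+ → ℂ) (σ : V → ℂ) : FockOp ι V :=
  fun s t => if s.1 = t.1 + h then σ t.1 * gaussKernel C D s.2 t.2 else 0

lemma hasSum_gaussOp_mul_gaussOp {h h' : V} {c d C D : ι × ℕ+ → ℂ} {σ σ' : V → ℂ}
    (hs : Summable fun m => d m * C m) (s t : FockState ι V) :
    HasSum (fun u => gaussOp h c d σ s u * gaussOp h' C D σ' u t)
      (gaussOp (h + h') (c + C) (d + D)
        (fun lam => Complex.exp (∑' m, d m * C m) * (σ (lam + h') * σ' lam)) s t) := by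
  -- The right factor forces the intermediate momentum to be `t.1 + h'`, so only occupation numbers
  -- are summed.
  have hinj : Function.Injective fun α : (ι × ℕ+) →₀ ℕ => ((t.1 + h', α) : FockState ι V) :=
    fun α β hab => (Prod.ext_iff.1 hab).2
  rw [← hinj.hasSum_iff]
  · by_cases hst : s.1 = t.1 + (h + h')
    · have hst' : s.1 = t.1 + h' + h := by rw [hst]; abel
      refine HasSum.congr_fun (f := fun u => σ (t.1 + h') * σ' t.1 *
        (gaussKernel c d s.2 u * gaussKernel C D u t.2)) ?_ fun u => ?_
      · rw [gaussOp, if_pos hst]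
        convert! (hasSum_gaussKernel_mul_gaussKernel hs s.2 t.2).mul_left
          (σ (t.1 + h') * σ' t.1) using 1
        ring
      · simp only [Function.comp_apply, gaussOp, if_pos hst', if_true]
        ring
    · have hst' : ¬ s.1 = t.1 + h' + h := fun h1 => hst (by rw [h1]; abel)
      rw [gaussOp, if_neg hst]
      refine hasSum_zero.congr_fun fun u => ?_
      simp only [Function.comp_apply, gaussOp, if_neg hst', zero_mul]
  · intro u hu
    rw [gaussOp, gaussOp, if_neg (c := u.1 = t.1 + h'), mul_zero]
    intro h1
    exact hu ⟨u.2, Prod.ext h1.symm rfl⟩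

lemma opMul_gaussOp {h h' : V} {c d C D : ι × ℕ+ → ℂ} {σ σ' : V → ℂ}
    (hs : Summable fun m => d m * C m) :
    opMul (gaussOp h c d σ) (gaussOp h' C D σ') = gaussOp (h + h') (c + C) (d + D)
        (fun lam => Complex.exp (∑' m, d m * C m) * (σ (lam + h') * σ' lam)) := by
  funext s t
  exact (hasSum_gaussOp_mul_gaussOp hs s t).tsum_eq

lemma gaussKernel_zero_zero (α β : M →₀ ℕ) [Decidable (α = β)] :
    gaussKernel 0 0 α β = if α = β then 1 else 0 := by
  split_ifs with h
  · rw [h, gaussKernel_raising_self]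
  · obtain ⟨m, hm⟩ := Finsupp.ne_iff.1 h
    rcases lt_or_gt_of_ne hm with h1 | h1
    · exact gaussKernel_raising_eq_zero h1
    · exact gaussKernel_lowering_eq_zero h1

lemma gaussOp_zero (σ : V → ℂ) :
    (gaussOp 0 0 0 σ : FockOp ι V) = diagOp fun s => σ s.1 := by
  classical
  funext s t
  rw [gaussOp, diagOp, add_zero, gaussKernel_zero_zero]
  by_cases h : s = t
  · simp [h]
  · rw [if_neg h]
    split_ifs with h1 h2
    · exact absurd (Prod.ext h1 h2) h
    · simp
    · rfl

/-- The product of operators with Gaussian matrix elements. -/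
lemma opProd_gaussOp {L : List (FockOp ι V)} (hL : OpProdConverges L) {Q : FockState ι V → ℂ}
    (hQ : ∀ s t, opProd L s t = gaussOp 0 0 0 1 s t * Q t) :
    ∀ {N : ℕ} (h : Fin N → V) (c d : Fin N → ι × ℕ+ → ℂ) (σ : Fin N → V → ℂ)
      (_ : ∀ i j, i < j → Summable fun m => d i m * c j m),
      OpProdConverges (List.ofFn (fun i => gaussOp (h i) (c i) (d i) (σ i)) ++ L) ∧
      ∀ s t, opProd (List.ofFn (fun i => gaussOp (h i) (c i) (d i) (σ i)) ++ L) s t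
        = gaussOp (∑ i, h i) (∑ i, c i) (∑ i, d i)
          (fun lam => Complex.exp (∑ i, ∑ j ∈ Ioi i, ∑' m, d i m * c j m)
            * ∏ i, σ i (lam + ∑ j ∈ Ioi i, h j)) s t * Q t := by
  intro N
  induction N with
  | zero =>
    intro h c d σ _
    refine ⟨by simpa using hL, fun s t => ?_⟩
    simp only [List.ofFn_zero, List.nil_append, hQ, univ_eq_empty, sum_empty, prod_empty,
      Complex.exp_zero, mul_one]
    rfl
  | succ N ih =>
    intro h c d σ hs
    obtain ⟨ih1, ih2⟩ := ih (fun i => h i.succ) (fun i => c i.succ) (fun i => d i.succ)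
      (fun i => σ i.succ) fun i j hij => hs _ _ (Fin.succ_lt_succ_iff.2 hij)
    have hs0 : ∀ j ∈ (univ : Finset (Fin N)), Summable fun m => d 0 m * c j.succ m :=
      fun j _ => hs _ _ (Fin.succ_pos j)
    have hs1 : Summable fun m => d 0 m * (∑ j : Fin N, c j.succ) m := by
      refine (summable_sum hs0).congr fun m => ?_
      rw [Finset.sum_apply, mul_sum]
    have hs2 : ∑' m, d 0 m * (∑ j : Fin N, c j.succ) m
        = ∑ j : Fin N, ∑' m, d 0 m * c j.succ m := by
      rw [← Summable.tsum_finsetSum hs0]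
      exact tsum_congr fun m => by rw [Finset.sum_apply, mul_sum]
    -- The leftmost factor meets the already ordered product of the others. The eigenvalue `Q t`
    -- depends on occupation numbers, so it is not of Gaussian form; attached to the rightmost
    -- state, it passes through all intermediate sums.
    have key := fun s t => (hasSum_gaussOp_mul_gaussOp (h := h 0) (h' := ∑ i : Fin N, h i.succ)
      (c := c 0) (D := ∑ i : Fin N, d i.succ) (σ := σ 0)
      (σ' := fun lam => Complex.exp (∑ i : Fin N, ∑ j ∈ Ioi i, ∑' m, d i.succ m * c j.succ m)
            * ∏ i : Fin N, σ i.succ (lam + ∑ j ∈ Ioi i, h j.succ)) hs1 s t).mul_right (Q t)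
    simp only [List.ofFn_succ, List.cons_append, OpProdConverges, opProd, opMul, ih2]
    refine ⟨⟨fun s t => (key s t).summable.congr fun u => by ring, ih1⟩, fun s t => ?_⟩
    rw [tsum_congr fun u => (mul_assoc _ _ _).symm, (key s t).tsum_eq]
    simp only [Fin.sum_univ_succ, Fin.prod_univ_succ, Fin.sum_Ioi_zero, Fin.sum_Ioi_succ, hs2,
      Complex.exp_add]
    congr 2
    funext lam
    ring

end Gauss

/-! ### Exponentials of creation and annihilation operators -/

section Exponentials

variable {ι V : Type*} [AddCommGroup V]

/-- `A` is multiplication by the linear form `∑ c_m x_m`, possibly infinite. The k-th term of its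
exponential is the part of the raising kernel that increases the degree by exactly `k`; at most one
`k` contributes to a given entry. -/
lemma opExp_creation {A : FockOp ι V} {c : ι × ℕ+ → ℂ}
    (h1 : ∀ t m, A (t.1, t.2 + Finsupp.single m 1) t = c m)
    (h2 : ∀ s t, (∀ m, s ≠ (t.1, t.2 + Finsupp.single m 1)) → A s t = 0) :
    opExp A = gaussOp 0 c 0 1 := by
  classical
  funext s t
  rw [opExp_eq_tsum (fun k s t =>
    if s.1 = t.1 ∧ s.2.degree = t.2.degree + k then gaussKernel c 0 s.2 t.2 else 0)]
  · rw [gaussOp, add_zero]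
    by_cases hm : s.1 = t.1
    · simp only [hm, true_and, if_true, Pi.one_apply, one_mul]
      by_cases hle : ∀ m, t.2 m ≤ s.2 m
      · have hd : t.2.degree ≤ s.2.degree := Finsupp.degree_mono hle
        obtain ⟨k, hk⟩ := Nat.exists_eq_add_of_le hd
        rw [tsum_eq_single k fun j hj => if_neg (by omega), if_pos hk]
      · obtain ⟨m, hm⟩ := not_forall.1 hle
        rw [gaussKernel_raising_eq_zero (not_le.1 hm)]
        simp
    · simp [hm]
  · funext s t
    simp only [opOne, add_zero]
    by_cases h : s = t
    · subst h
      simp [gaussKernel_raising_self]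
    · rw [if_neg h]
      split_ifs with h'
      · by_cases hle : ∀ m, t.2 m ≤ s.2 m
        · exact absurd (Prod.ext h'.1 (eq_of_le_of_degree_eq hle h'.2)) h
        · obtain ⟨m, hm⟩ := not_forall.1 hle
          exact gaussKernel_raising_eq_zero (not_le.1 hm)
      · rfl
  · intro k s t
    have hA : ∀ m ∈ s.2.support, A s (s.1, s.2 - Finsupp.single m 1) = c m := fun m hm => by
      have h := h1 (s.1, s.2 - Finsupp.single m 1) m
      rwa [tsub_add_cancel_of_le (Finsupp.single_le_iff.2 (Nat.one_le_iff_ne_zero.2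
        (Finsupp.mem_support_iff.1 hm)))] at h
    have hinj : Set.InjOn (fun m => ((s.1, s.2 - Finsupp.single m 1) : FockState ι V))
        s.2.support := fun m hm m' hm' h => by
      by_contra hne
      have h := congrArg (fun u : FockState ι V => u.2 m) h
      have := Finsupp.mem_support_iff.1 hm
      simp [Ne.symm hne] at h
      omega
    -- The states from which `s` is reached by one creation: remove one quantum from an oscillator
    -- occupied in `s`.
    rw [tsum_eq_sum (s := s.2.support.image fun m =>
      ((s.1, s.2 - Finsupp.single m 1) : FockState ι V)), sum_image hinj]
    · have hdeg : ∀ m ∈ s.2.support,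
          (s.2 - Finsupp.single m 1).degree + 1 = s.2.degree := fun m hm => by
        have h := congrArg Finsupp.degree (tsub_add_cancel_of_le (Finsupp.single_le_iff.2
          (Nat.one_le_iff_ne_zero.2 (Finsupp.mem_support_iff.1 hm))))
        rwa [map_add, Finsupp.degree_single] at h
      by_cases hst : s.1 = t.1 ∧ s.2.degree = t.2.degree + (k + 1)
      · rw [if_pos hst]
        rw [show ((k : ℂ) + 1) = s.2.degree - t.2.degree by rw [hst.2]; push_cast; ring,
          ← sum_mul_gaussKernel_raising]
        refine sum_congr rfl fun m hm => ?_
        rw [hA m hm, if_pos ⟨hst.1, by have := hdeg m hm; simp only; omega⟩]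
      · rw [if_neg hst, mul_zero]
        refine sum_eq_zero fun m hm => ?_
        rw [if_neg, mul_zero]
        rintro ⟨h3, h4⟩
        exact hst ⟨h3, by have := hdeg m hm; simp only at h4; omega⟩
    · intro u hu
      rw [h2, zero_mul]
      rintro m rfl
      exact hu (mem_image.2 ⟨m, by simp, by simp⟩)

/-- The transposed argument for the derivation `∑ d_m ∂_m`: the k-th term is the part of the
lowering kernel that drops the degree by `k`. -/
lemma opExp_annihilation {A : FockOp ι V} {d : ι × ℕ+ → ℂ}
    (h1 : ∀ s m, A s (s.1, s.2 + Finsupp.single m 1) = d m * (s.2 m + 1))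
    (h2 : ∀ s t, (∀ m, t ≠ (s.1, s.2 + Finsupp.single m 1)) → A s t = 0) :
    opExp A = gaussOp 0 0 d 1 := by
  classical
  funext s t
  rw [opExp_eq_tsum (fun k s t =>
    if s.1 = t.1 ∧ t.2.degree = s.2.degree + k then gaussKernel 0 d s.2 t.2 else 0)]
  · rw [gaussOp, add_zero]
    by_cases hm : s.1 = t.1
    · simp only [hm, true_and, if_true, Pi.one_apply, one_mul]
      by_cases hle : ∀ m, s.2 m ≤ t.2 m
      · have hd : s.2.degree ≤ t.2.degree := Finsupp.degree_mono hle
        obtain ⟨k, hk⟩ := Nat.exists_eq_add_of_le hd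
        rw [tsum_eq_single k fun j hj => if_neg (by omega), if_pos hk]
      · obtain ⟨m, hm⟩ := not_forall.1 hle
        rw [gaussKernel_lowering_eq_zero (not_le.1 hm)]
        simp
    · simp [hm]
  · funext s t
    simp only [opOne, add_zero]
    by_cases h : s = t
    · subst h
      simp [gaussKernel_lowering_self]
    · rw [if_neg h]
      split_ifs with h'
      · by_cases hle : ∀ m, s.2 m ≤ t.2 m
        · exact absurd (Prod.ext h'.1 (eq_of_le_of_degree_eq hle h'.2).symm) h
        · obtain ⟨m, hm⟩ := not_forall.1 hle
          exact gaussKernel_lowering_eq_zero (not_le.1 hm)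
      · rfl
  · intro k s t
    have hinj : Set.InjOn (fun m => ((s.1, s.2 + Finsupp.single m 1) : FockState ι V))
        t.2.support := fun m _ m' _ h => by
      by_contra hne
      have h := congrArg (fun u : FockState ι V => u.2 m) h
      simp [Ne.symm hne] at h
    rw [tsum_eq_sum (s := t.2.support.image fun m =>
      ((s.1, s.2 + Finsupp.single m 1) : FockState ι V)), sum_image hinj]
    · have hdeg : ∀ m, (s.2 + Finsupp.single m 1).degree = s.2.degree + 1 := fun m => by
        rw [map_add, Finsupp.degree_single]
      by_cases hst : s.1 = t.1 ∧ t.2.degree = s.2.degree + (k + 1)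
      · rw [if_pos hst]
        rw [show ((k : ℂ) + 1) = t.2.degree - s.2.degree by rw [hst.2]; push_cast; ring,
          ← sum_mul_gaussKernel_lowering]
        refine sum_congr rfl fun m hm => ?_
        rw [h1, if_pos ⟨hst.1, by have := hdeg m; simp only; omega⟩]
      · rw [if_neg hst, mul_zero]
        refine sum_eq_zero fun m hm => ?_
        rw [if_neg, mul_zero]
        rintro ⟨h3, h4⟩
        exact hst ⟨h3, by have := hdeg m; simp only at h4; omega⟩
    · intro u hu
      by_cases hu' : ∃ m, u = (s.1, s.2 + Finsupp.single m 1)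
      · obtain ⟨m, rfl⟩ := hu'
        -- Such a `u` has a quantum in an oscillator empty in `t`, which lowering cannot produce.
        have hm : t.2 m = 0 := by
          by_contra hm
          exact hu (mem_image.2 ⟨m, by simpa using hm, rfl⟩)
        split_ifs
        · rw [gaussKernel_lowering_eq_zero (m := m) (by simp [hm]), mul_zero]
        · rw [mul_zero]
      · rw [h2 _ _ fun m hm => hu' ⟨m, hm⟩, zero_mul]

lemma toOp_boost (h : V) : toOp (boost ι h) = gaussOp h 0 0 1 := by
  classical
  funext s t
  rw [toOp, ket, boost, Finsupp.lmapDomain_apply, Finsupp.mapDomain_single, Finsupp.single_apply,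
    gaussOp, gaussKernel_zero_zero]
  by_cases h1 : s.1 = t.1 + h
  · simp [h1, MvPolynomial.coeff_monomial, eq_comm]
  · simp [h1, Ne.symm h1]

lemma succPNat_injective_pair {i j : ι} {n k : ℕ} {α : (ι × ℕ+) →₀ ℕ}
    (h : α + Finsupp.single (i, n.succPNat) 1 = α + Finsupp.single (j, k.succPNat) 1) :
    n = k := by
  have h1 := Finsupp.single_left_injective one_ne_zero (add_left_cancel h)
  simpa using (Prod.ext_iff.1 h1).2

end Exponentials

/-! ### Matrix elements of the free bosons -/

section Modes

variable {ι V : Type*} [AddCommGroup V] [Module ℂ V] [Fintype ι] (κ : ℂ)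
  (B : LinearMap.BilinForm ℂ V) (b : Module.Basis ι ℂ V)

lemma phi_single (h lam : V) (m : ℤ) (p : MvPolynomial (ι × ℕ+) ℂ) :
    phi κ B b h m (Finsupp.single lam p) = Finsupp.single lam (fockMode κ B b lam h m p) := by
  simp [phi]

lemma fockMode_zero (lam h : V) (p : MvPolynomial (ι × ℕ+) ℂ) :
    fockMode κ B b lam h 0 p = B lam h • p := rfl

lemma fockMode_pos (lam h : V) (n : ℕ) (p : MvPolynomial (ι × ℕ+) ℂ) :
    fockMode κ B b lam h (n + 1) p
      = ∑ i, (κ * (n + 1) * B h (b i)) • MvPolynomial.pderiv (i, n.succPNat) p := by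
  change (∑ i, (κ * (n + 1) * B h (b i)) • (MvPolynomial.pderiv (i, n.succPNat)).toLinearMap) p = _
  simp

lemma fockMode_neg (lam h : V) (n : ℕ) (p : MvPolynomial (ι × ℕ+) ℂ) :
    fockMode κ B b lam h (-(n + 1)) p
      = ∑ i, b.repr h i • (MvPolynomial.X (i, n.succPNat) * p) := by
  rw [show (-((n : ℤ) + 1)) = Int.negSucc n by omega]
  change (∑ i, MvPolynomial.C (b.repr h i) * MvPolynomial.X (i, n.succPNat)) * p = _
  rw [sum_mul]
  refine sum_congr rfl fun i _ => ?_
  rw [mul_assoc, MvPolynomial.C_mul']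

lemma toOp_phi (h : V) (m : ℤ) (s t : FockState ι V) [Decidable (t.1 = s.1)] :
    toOp (phi κ B b h m) s t = if t.1 = s.1 then
      MvPolynomial.coeff s.2 (fockMode κ B b t.1 h m (MvPolynomial.monomial t.2 1)) else 0 := by
  rw [toOp, ket, phi_single, Finsupp.single_apply]
  split_ifs <;> simp

lemma toOp_phi_zero (h : V) :
    toOp (phi κ B b h 0) = (diagOp fun s => B s.1 h : FockOp ι V) := by
  classical
  funext s t
  rw [toOp_phi, diagOp, fockMode_zero, MvPolynomial.coeff_smul, MvPolynomial.coeff_monomial]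
  by_cases h : s = t
  · simp [h]
  · rw [if_neg h]
    split_ifs with h1 h2
    · exact absurd (Prod.ext h1.symm h2.symm) h
    · simp
    · rfl

open Classical in
lemma coeff_X_mul_monomial {M : Type*} (m : M) (α β : M →₀ ℕ) (a : ℂ) :
    MvPolynomial.coeff α (MvPolynomial.X m * MvPolynomial.monomial β a)
      = if α = β + Finsupp.single m 1 then a else 0 := by
  rw [MvPolynomial.X, MvPolynomial.monomial_mul, one_mul, add_comm, MvPolynomial.coeff_monomial]
  simp only [eq_comm]

/-- The coefficients of the creation operators in the exponent of a vertex operator. -/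
def creationCoeff (h : V) (z : ℂ) (m : ι × ℕ+) : ℂ :=
  z ^ (m.2 : ℕ) / (κ * (m.2 : ℕ)) * b.repr h m.1

/-- The coefficients of the derivations in the exponent of a vertex operator. -/
def annihilationCoeff (h : V) (z : ℂ) (m : ι × ℕ+) : ℂ :=
  -((z ^ (m.2 : ℕ))⁻¹ * B h (b m.1))

lemma toOp_phi_neg_of_ne (h : V) (n : ℕ) {s t : FockState ι V}
    (hst : ∀ i, s ≠ (t.1, t.2 + Finsupp.single (i, n.succPNat) 1)) :
    toOp (phi κ B b h (-(n + 1))) s t = 0 := by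
  classical
  rw [toOp_phi]
  split_ifs with h1
  · rw [fockMode_neg, MvPolynomial.coeff_sum]
    refine sum_eq_zero fun i _ => ?_
    rw [MvPolynomial.coeff_smul, coeff_X_mul_monomial, if_neg, smul_zero]
    exact fun h2 => hst i (Prod.ext h1.symm h2)
  · rfl

lemma toOp_phi_neg_succ (h : V) (n : ℕ) (i : ι) (t : FockState ι V) :
    toOp (phi κ B b h (-(n + 1))) (t.1, t.2 + Finsupp.single (i, n.succPNat) 1) t
      = b.repr h i := by
  classical
  rw [toOp_phi, if_pos rfl, fockMode_neg, MvPolynomial.coeff_sum, sum_eq_single i]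
  · simp [MvPolynomial.coeff_smul, coeff_X_mul_monomial]
  · intro j _ hj
    rw [MvPolynomial.coeff_smul, coeff_X_mul_monomial, if_neg, smul_zero]
    intro h2
    simp [Finsupp.single_left_inj, hj.symm] at h2
  · simp

lemma coeff_pderiv_monomial_of_ne {M : Type*} {m : M} {α β : M →₀ ℕ}
    (h : β ≠ α + Finsupp.single m 1) :
    MvPolynomial.coeff α (MvPolynomial.pderiv m (MvPolynomial.monomial β (1 : ℂ))) = 0 := by
  classical
  rw [MvPolynomial.pderiv_monomial, MvPolynomial.coeff_monomial]
  split_ifs with h1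
  · by_cases hm : β m = 0
    · simp [hm]
    · refine absurd ?_ h
      rw [← h1, tsub_add_cancel_of_le (Finsupp.single_le_iff.2 (Nat.one_le_iff_ne_zero.2 hm))]
  · rfl

lemma toOp_phi_pos_of_ne (h : V) (n : ℕ) {s t : FockState ι V}
    (hst : ∀ i, t ≠ (s.1, s.2 + Finsupp.single (i, n.succPNat) 1)) :
    toOp (phi κ B b h (n + 1)) s t = 0 := by
  classical
  rw [toOp_phi]
  split_ifs with h1
  · rw [fockMode_pos, MvPolynomial.coeff_sum]
    refine sum_eq_zero fun i _ => ?_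
    rw [MvPolynomial.coeff_smul, coeff_pderiv_monomial_of_ne, smul_zero]
    exact fun h2 => hst i (Prod.ext h1 h2)
  · rfl

lemma toOp_phi_pos_succ (h : V) (n : ℕ) (i : ι) (s : FockState ι V) :
    toOp (phi κ B b h (n + 1)) s (s.1, s.2 + Finsupp.single (i, n.succPNat) 1)
      = κ * (n + 1) * B h (b i) * (s.2 (i, n.succPNat) + 1) := by
  classical
  rw [toOp_phi, if_pos rfl, fockMode_pos, MvPolynomial.coeff_sum, sum_eq_single i]
  · simp [MvPolynomial.coeff_smul, MvPolynomial.pderiv_monomial]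
    ring
  · intro j _ hj
    rw [MvPolynomial.coeff_smul, coeff_pderiv_monomial_of_ne, smul_zero]
    intro h2
    simp [Finsupp.single_left_inj, hj.symm] at h2
  · simp

variable {κ}

lemma opExp_halfField_neg (h : V) (z : ℂ) :
    opExp (halfField κ B b h z (-1)) = gaussOp 0 (creationCoeff κ b h z) 0 1 := by
  have e : ∀ n : ℕ, (-1 : ℤ) * (n + 1) = -((n : ℤ) + 1) := fun n => by ring
  refine opExp_creation (fun t m => ?_) fun s t hst => ?_
  · obtain ⟨i, p⟩ := m
    obtain ⟨n, rfl⟩ : ∃ n : ℕ, n.succPNat = p := ⟨p.natPred, PNat.succPNat_natPred p⟩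
    simp only [halfField, e]
    -- Only the mode of index `-(n+1)` adds a quantum to the oscillator `(i, n+1)`.
    rw [tsum_eq_single n, toOp_phi_neg_succ, creationCoeff]
    · have h1 : z ^ (-(-((n : ℤ) + 1))) = z ^ (n + 1) := by
        rw [neg_neg]; exact_mod_cast zpow_natCast z (n + 1)
      rw [h1, Nat.succPNat_coe]
      push_cast
      rw [neg_neg]
      field_simp
    · intro k hk
      rw [toOp_phi_neg_of_ne, mul_zero]
      intro j hj
      exact hk (succPNat_injective_pair (Prod.ext_iff.1 hj).2).symm
  · simp only [halfField, e]
    rw [tsum_congr fun n : ℕ => by rw [toOp_phi_neg_of_ne _ _ _ _ _ fun i => hst _, mul_zero],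
      tsum_zero, mul_zero]

lemma opExp_halfField_pos (hκ : κ ≠ 0) (h : V) (z : ℂ) :
    opExp (halfField κ B b h z 1) = gaussOp 0 0 (annihilationCoeff B b h z) 1 := by
  refine opExp_annihilation (fun t m => ?_) fun s t hst => ?_
  · obtain ⟨i, p⟩ := m
    obtain ⟨n, rfl⟩ : ∃ n : ℕ, n.succPNat = p := ⟨p.natPred, PNat.succPNat_natPred p⟩
    simp only [halfField, one_mul]
    rw [tsum_eq_single n, toOp_phi_pos_succ, annihilationCoeff]
    · have h1 : z ^ (-((n : ℤ) + 1)) = (z ^ (n + 1))⁻¹ := by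
        rw [zpow_neg]; exact_mod_cast congrArg _ (zpow_natCast z (n + 1))
      have h2 : ((n : ℂ) + 1) ≠ 0 := by exact_mod_cast n.succ_ne_zero
      rw [h1, Nat.succPNat_coe]
      push_cast
      generalize (z ^ (n + 1))⁻¹ = y
      field_simp
    · intro k hk
      rw [toOp_phi_pos_of_ne, mul_zero]
      intro j hj
      exact hk (succPNat_injective_pair (Prod.ext_iff.1 hj).2).symm
  · simp only [halfField, one_mul]
    rw [tsum_congr fun n : ℕ => by rw [toOp_phi_pos_of_ne _ _ _ _ _ fun i => hst _, mul_zero],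
      tsum_zero, mul_zero]

/-- The four factors are already normally ordered, so composing them produces no scalar. The
zero-mode factor stands to the right of the boost and is evaluated at the incoming momentum. -/
lemma vertexOp_eq_gaussOp (hκ : κ ≠ 0) (h : V) (x : ℂ) :
    vertexOp κ B b h x = gaussOp h (creationCoeff κ b h (expTwoPiI x))
      (annihilationCoeff B b h (expTwoPiI x)) fun lam => expTwoPiI (B lam h / κ * x) := by
  have h1 : (fun s t : FockState ι V =>
      2 * Real.pi * Complex.I * x / κ * toOp (phi κ B b h 0) s t)
      = diagOp fun s => 2 * Real.pi * Complex.I * x / κ * B s.1 h := by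
    funext s t
    rw [toOp_phi_zero, diagOp, diagOp, mul_ite, mul_zero]
  have h2 : opOne ι V = gaussOp 0 0 0 1 := by rw [gaussOp_zero]; rfl
  have h3 : (diagOp fun s : FockState ι V => Complex.exp (2 * Real.pi * Complex.I * x / κ * B s.1 h))
      = gaussOp 0 0 0 fun lam => expTwoPiI (B lam h / κ * x) := by
    rw [gaussOp_zero]
    congr 1
    funext s
    rw [expTwoPiI]
    congr 1
    ring
  rw [vertexOp, h1, opExp_diagOp, h3, opExp_halfField_neg, opExp_halfField_pos B b hκ, toOp_boost]
  simp only [opProd, h2]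
  rw [opMul_gaussOp, opMul_gaussOp, opMul_gaussOp, opMul_gaussOp]
  · simp
  all_goals simp

end Modes

/-! ### The energy operator -/

section Energy

variable {ι V : Type*}

/-- The energy `∑ n α(i, n)` of a state above the vacuum. -/
def oscillatorEnergy (α : (ι × ℕ+) →₀ ℕ) : ℂ := α.sum fun m a => ((m.2 : ℕ) : ℂ) * a

lemma hasSum_oscillatorEnergy [Fintype ι] (α : (ι × ℕ+) →₀ ℕ) :
    HasSum (fun n : ℕ => ((n : ℂ) + 1) * ∑ i, (α (i, n.succPNat) : ℂ)) (oscillatorEnergy α) := by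
  have h : HasSum (fun m : ι × ℕ+ => ((m.2 : ℕ) : ℂ) * α m) (oscillatorEnergy α) :=
    hasSum_sum_of_ne_finset_zero fun m hm => by
      rw [Finsupp.notMem_support_iff.1 hm]; simp
  rw [← (((Equiv.prodComm ℕ ι).trans
    ((Equiv.refl ι).prodCongr Equiv.pnatEquivNat.symm))).hasSum_iff] at h
  refine (h.prod_fiberwise fun n => hasSum_fintype _).congr_fun fun n => ?_
  rw [mul_sum]
  refine sum_congr rfl fun i _ => ?_
  simp

lemma hasSum_diagOp {M : Type*} {δ : M → FockState ι V → ℂ} {δ' : FockState ι V → ℂ}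
    (h : ∀ s, HasSum (fun m => δ m s) (δ' s)) (s t : FockState ι V) :
    HasSum (fun m => diagOp (δ m) s t) (diagOp δ' s t) := by
  by_cases hst : s = t
  · simpa only [diagOp, if_pos hst] using h t
  · simpa only [diagOp, if_neg hst] using hasSum_zero

variable [AddCommGroup V] [Module ℂ V] [Fintype ι] (κ : ℂ)
  (B : LinearMap.BilinForm ℂ V) (b : Module.Basis ι ℂ V)

lemma toOp_phi_mul_phi (h h' : V) (m m' : ℤ) (s t : FockState ι V) [Decidable (t.1 = s.1)] :
    toOp (phi κ B b h' m' * phi κ B b h m) s t = if t.1 = s.1 then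
      MvPolynomial.coeff s.2 (fockMode κ B b t.1 h' m'
        (fockMode κ B b t.1 h m (MvPolynomial.monomial t.2 1))) else 0 := by
  rw [toOp, ket, Module.End.mul_apply, phi_single, phi_single, Finsupp.single_apply]
  split_ifs <;> simp

lemma coeff_fockMode_neg_fockMode_pos (lam h h' : V) (n : ℕ) (α β : (ι × ℕ+) →₀ ℕ) :
    MvPolynomial.coeff α (fockMode κ B b lam h' (-(n + 1))
        (fockMode κ B b lam h (n + 1) (MvPolynomial.monomial β 1)))
      = ∑ j, ∑ k, b.repr h' j * B h (b k) * (κ * (n + 1) * MvPolynomial.coeff α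
        (MvPolynomial.X (j, n.succPNat) * MvPolynomial.pderiv (k, n.succPNat)
          (MvPolynomial.monomial β (1 : ℂ)))) := by
  rw [fockMode_neg, fockMode_pos, MvPolynomial.coeff_sum]
  refine sum_congr rfl fun j _ => ?_
  rw [MvPolynomial.coeff_smul, mul_sum, MvPolynomial.coeff_sum, smul_sum]
  refine sum_congr rfl fun k _ => ?_
  rw [mul_smul_comm, MvPolynomial.coeff_smul, smul_eq_mul, smul_eq_mul]
  ring

lemma toOp_phi_neg_mul_phi_pos_eq_zero (h h' : V) (n : ℕ) (s : FockState ι V)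
    {t : FockState ι V} (ht : ∀ k, t.2 (k, n.succPNat) = 0) :
    toOp (phi κ B b h' (-(n + 1)) * phi κ B b h (n + 1)) s t = 0 := by
  classical
  rw [toOp_phi_mul_phi, coeff_fockMode_neg_fockMode_pos]
  split_ifs
  · refine sum_eq_zero fun j _ => sum_eq_zero fun k _ => ?_
    simp [MvPolynomial.pderiv_monomial, ht]
  · rfl

/-- Duality of `h` and `h'` contracts the double sum to `∑_k x_k ∂_k`, the number operator of level
`n+1`, which is diagonal on monomials. Both signs of the mode are covered, by exchanging the basis
with its dual. -/
lemma sum_toOp_phi_neg_mul_phi_pos [DecidableEq ι] {h h' : ι → V}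
    (hδ : ∀ j k, ∑ i, b.repr (h' i) j * B (h i) (b k) = if j = k then 1 else 0) (n : ℕ)
    (s t : FockState ι V) :
    ∑ i, toOp (phi κ B b (h' i) (-(n + 1)) * phi κ B b (h i) (n + 1)) s t
      = diagOp (fun s => κ * ((n + 1) * ∑ k, (s.2 (k, n.succPNat) : ℂ))) s t := by
  classical
  simp only [toOp_phi_mul_phi, coeff_fockMode_neg_fockMode_pos, diagOp]
  by_cases h1 : t.1 = s.1
  · simp only [h1, if_true]
    rw [sum_comm, sum_congr rfl fun j _ => sum_comm]
    simp only [← sum_mul, hδ, ite_mul, one_mul, zero_mul, sum_ite_eq, mem_univ, if_true]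
    have e : ∀ k, MvPolynomial.coeff s.2 (MvPolynomial.X (k, n.succPNat)
        * MvPolynomial.pderiv (k, n.succPNat) (MvPolynomial.monomial t.2 (1 : ℂ)))
        = if s = t then (t.2 (k, n.succPNat) : ℂ) else 0 := fun k => by
      rw [MvPolynomial.X_mul_pderiv_monomial, MvPolynomial.coeff_smul,
        MvPolynomial.coeff_monomial]
      by_cases h2 : t.2 = s.2
      · simp [h2, (Prod.ext h1.symm h2.symm : s = t)]
      · have h3 : s ≠ t := fun h => h2 (h ▸ rfl)
        simp [h2, h3]
    rw [← mul_sum, sum_congr rfl fun k _ => e k]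
    split_ifs
    · ring
    · simp
  · have h2 : s ≠ t := fun h => h1 (h ▸ rfl)
    simp [h1, h2]

lemma normalOrdered_pos (h h' : V) (n : ℕ) :
    normalOrdered κ B b h h' (n + 1) = phi κ B b h' (-(n + 1)) * phi κ B b h (n + 1) :=
  if_pos (by omega)

lemma normalOrdered_neg (h h' : V) (n : ℕ) :
    normalOrdered κ B b h h' (-(n + 1)) = phi κ B b h (-(n + 1)) * phi κ B b h' (n + 1) := by
  rw [normalOrdered, if_neg (by omega), neg_neg]

lemma toOp_normalOrdered_zero (h h' : V) :
    toOp (normalOrdered κ B b h h' 0) = (diagOp fun s => B s.1 h * B s.1 h' : FockOp ι V) := by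
  classical
  funext s t
  rw [normalOrdered, if_neg (lt_irrefl _), neg_zero, toOp_phi_mul_phi, fockMode_zero,
    fockMode_zero, diagOp, MvPolynomial.coeff_smul, MvPolynomial.coeff_smul,
    MvPolynomial.coeff_monomial]
  by_cases h : s = t
  · simp [h]
  · rw [if_neg h]
    split_ifs with h1 h2
    · exact absurd (Prod.ext h1.symm h2.symm) h
    · simp
    · rfl

/-- Only the zero mode and modes with `|m|` an occupied level of `t` act nontrivially. This licenses
exchanging the sum over the basis with the one over `m`. -/
lemma summable_toOp_normalOrdered (h h' : V) (s t : FockState ι V) :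
    Summable fun m : ℤ => toOp (normalOrdered κ B b h h' m) s t := by
  classical
  refine summable_of_ne_finset_zero (s := insert 0
    (t.2.support.image (fun k => ((k.2 : ℕ) : ℤ)) ∪ t.2.support.image fun k => -((k.2 : ℕ) : ℤ)))
    fun m hm => ?_
  simp only [mem_insert, mem_union, mem_image, Finsupp.mem_support_iff, not_or, not_exists,
    not_and] at hm
  obtain ⟨h0, h1, h2⟩ := hm
  rcases lt_or_gt_of_ne h0 with hm | hm
  · obtain ⟨n, rfl⟩ : ∃ n : ℕ, m = -((n : ℤ) + 1) := ⟨(-m).toNat - 1, by omega⟩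
    rw [normalOrdered_neg]
    refine toOp_phi_neg_mul_phi_pos_eq_zero κ B b _ _ n s fun k => ?_
    by_contra hk
    exact h2 _ hk (by simp)
  · obtain ⟨n, rfl⟩ : ∃ n : ℕ, m = (n : ℤ) + 1 := ⟨m.toNat - 1, by omega⟩
    rw [normalOrdered_pos]
    refine toOp_phi_neg_mul_phi_pos_eq_zero κ B b _ _ n s fun k => ?_
    by_contra hk
    exact h1 _ hk (by simp)

variable [DecidableEq ι] (hB : B.Nondegenerate)

lemma sum_repr_basis_mul_dualBasis (j k : ι) :
    ∑ i, b.repr (b i) j * B (B.dualBasis hB b i) (b k) = if j = k then 1 else 0 := by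
  simp only [LinearMap.BilinForm.apply_dualBasis_left, Module.Basis.repr_self,
    Finsupp.single_apply]
  simp [eq_comm]

variable {B}

lemma sum_apply_smul_dualBasis (hs : B.IsSymm) (v : V) :
    ∑ i, B (b i) v • B.dualBasis hB b i = v := by
  have := (B.dualBasis hB b).sum_repr v
  simpa only [LinearMap.BilinForm.dualBasis_repr_apply, hs.eq v] using this

lemma sum_repr_dualBasis_mul_basis (hs : B.IsSymm) (j k : ι) :
    ∑ i, b.repr (B.dualBasis hB b i) j * B (b i) (b k) = if j = k then 1 else 0 := by
  have h := congrArg (fun v => b.repr v j) (sum_apply_smul_dualBasis b hB hs (b k))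
  simp only [map_sum, map_smul, Finsupp.coe_finsetSum, Finset.sum_apply, Finsupp.smul_apply,
    smul_eq_mul, Module.Basis.repr_self, Finsupp.single_apply] at h
  simpa only [mul_comm, eq_comm] using h

lemma sum_apply_mul_apply_dualBasis (hs : B.IsSymm) (v : V) :
    ∑ i, B v (b i) * B v (B.dualBasis hB b i) = B v v := by
  have h := congrArg (B v) (sum_apply_smul_dualBasis b hB hs v)
  simp only [map_sum, map_smul, smul_eq_mul] at h
  rw [← h]
  exact sum_congr rfl fun i _ => by rw [hs.eq v (b i)]

variable {κ}

lemma energyZeroMode_eq_diagOp (hκ : κ ≠ 0) (hs : B.IsSymm) (ρ : V) :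
    energyZeroMode κ B hB b ρ = (diagOp fun s =>
      B s.1 (s.1 + (2 : ℂ) • ρ) / (2 * κ) + oscillatorEnergy s.2 : FockOp ι V) := by
  funext s t
  have hpos : HasSum (fun n : ℕ =>
      ∑ i, toOp (normalOrdered κ B b (b i) (B.dualBasis hB b i) (n + 1)) s t)
      (diagOp (fun s => κ * oscillatorEnergy s.2) s t) := by
    simp only [normalOrdered_pos]
    simp only [sum_toOp_phi_neg_mul_phi_pos κ B b (sum_repr_dualBasis_mul_basis b hB hs)]
    exact hasSum_diagOp (fun s => (hasSum_oscillatorEnergy s.2).mul_left κ) s t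
  have hneg : HasSum (fun n : ℕ =>
      ∑ i, toOp (normalOrdered κ B b (b i) (B.dualBasis hB b i) (-(n + 1))) s t)
      (diagOp (fun s => κ * oscillatorEnergy s.2) s t) := by
    simp only [normalOrdered_neg]
    simp only [sum_toOp_phi_neg_mul_phi_pos κ B b (sum_repr_basis_mul_dualBasis B b hB)]
    exact hasSum_diagOp (fun s => (hasSum_oscillatorEnergy s.2).mul_left κ) s t
  -- Positive and negative modes each give `κ` times the oscillator energy, cancelling the prefactor
  -- `1/(2κ)`; the zero mode gives `(λ|λ)`.
  have hsum := hpos.of_add_one_of_neg_add_one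
    (f := fun m => ∑ i, toOp (normalOrdered κ B b (b i) (B.dualBasis hB b i) m) s t) hneg
  rw [energyZeroMode, ← Summable.tsum_finsetSum fun i _ =>
    summable_toOp_normalOrdered κ B b _ _ s t, hsum.tsum_eq, toOp_phi_zero]
  simp only [toOp_normalOrdered_zero]
  by_cases h : s = t
  · simp only [diagOp, if_pos h, sum_apply_mul_apply_dualBasis b hB hs, map_add]
    field_simp
    ring
  · simp [diagOp, if_neg h]

end Energy

/-! ### Summation of the exponents -/

section Exponents

lemma hasSum_prod_of_fintype {ι α E : Type*} [Fintype ι] [AddCommMonoid E] [TopologicalSpace E]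
    [ContinuousAdd E] {f : ι × α → E} {g : ι → E} (h : ∀ i, HasSum (fun a => f (i, a)) (g i)) :
    HasSum f (∑ i, g i) := by
  classical
  have h1 : ∀ i ∈ (univ : Finset ι),
      HasSum (fun m : ι × α => if m.1 = i then f m else 0) (g i) := by
    intro i _
    have hinj : Function.Injective fun a : α => (i, a) := fun a a' h => (Prod.ext_iff.1 h).2
    rw [← hinj.hasSum_iff]
    · simpa [Function.comp_def] using h i
    · intro m hm
      rw [if_neg]
      exact fun h => hm ⟨m.2, Prod.ext h.symm rfl⟩
  refine (hasSum_sum h1).congr_fun fun m => ?_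
  simp

lemma hasSum_pnat_iff {E : Type*} [AddCommMonoid E] [TopologicalSpace E] {f : ℕ+ → E} {a : E} :
    HasSum f a ↔ HasSum (fun n : ℕ => f n.succPNat) a :=
  (Equiv.pnatEquivNat.symm.hasSum_iff).symm

lemma hasSum_pow_succ_div {y : ℂ} (hy : ‖y‖ < 1) :
    HasSum (fun n : ℕ => y ^ (n + 1) / (n + 1)) (-Complex.log (1 - y)) := by
  have h := (hasSum_nat_add_iff' 1).2 (Complex.hasSum_taylorSeries_neg_log hy)
  simpa using h

lemma logQPochhammer_eq_add {a q : ℂ} (hq : ‖q‖ < 1) :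
    logQPochhammer a q = Complex.log (1 - a) + logQPochhammer (q * a) q := by
  rw [logQPochhammer, (summable_log_qPochhammer a hq).tsum_eq_zero_add, logQPochhammer]
  congr 1
  · simp
  · exact tsum_congr fun n => by rw [pow_succ]; ring_nf

/-- The terms of the double series of `∑ y^n q^n / (n (1 - q^n))`. -/
def lambertTerm (y q : ℂ) (n r : ℕ) : ℂ := (q * y * q ^ r) ^ (n + 1) / (n + 1)

/-- Dominated by a product of two geometric series. Only `|qy| < 1` is needed, not `|y| < 1`, so all
ordered pairs `(z_i, z_j)` are covered. -/
lemma summable_lambertTerm {y q : ℂ} (hq : ‖q‖ < 1) (hqy : ‖q * y‖ < 1) :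
    Summable fun p : ℕ × ℕ => lambertTerm y q p.1 p.2 := by
  have h1 : Summable fun p : ℕ × ℕ => ‖q * y‖ ^ p.1 * ‖q‖ ^ p.2 :=
    (summable_geometric_of_lt_one (norm_nonneg _) hqy).mul_of_nonneg
      (summable_geometric_of_lt_one (norm_nonneg _) hq) (fun _ => by positivity)
      fun _ => by positivity
  refine Summable.of_norm_bounded h1 fun p => ?_
  have h2 : ‖((p.1 : ℂ) + 1)‖ = (p.1 : ℝ) + 1 := by
    rw [← Nat.cast_succ, Complex.norm_natCast, Nat.cast_succ]
  rw [lambertTerm, norm_div, h2, norm_pow, norm_mul, norm_pow, mul_pow, ← pow_mul]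
  refine (div_le_self (by positivity) (by linarith [Nat.cast_nonneg (α := ℝ) p.1])).trans ?_
  refine mul_le_mul (pow_le_pow_of_le_one (norm_nonneg _) hqy.le (Nat.le_succ _))
    (pow_le_pow_of_le_one (norm_nonneg _) hq.le (Nat.le_mul_of_pos_right _ (Nat.succ_pos _)))
    (by positivity) (by positivity)

lemma hasSum_lambertTerm_right {y q : ℂ} (hq : ‖q‖ < 1) (n : ℕ) :
    HasSum (lambertTerm y q n) (y ^ (n + 1) / (n + 1) * (q ^ (n + 1) / (1 - q ^ (n + 1)))) := by
  have hqn : ‖q ^ (n + 1)‖ < 1 := by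
    rw [norm_pow]; exact pow_lt_one₀ (norm_nonneg _) hq n.succ_ne_zero
  have h := (hasSum_geometric_of_norm_lt_one hqn).mul_left ((q * y) ^ (n + 1) / ((n : ℂ) + 1))
  rw [show y ^ (n + 1) / ((n : ℂ) + 1) * (q ^ (n + 1) / (1 - q ^ (n + 1)))
    = (q * y) ^ (n + 1) / ((n : ℂ) + 1) * (1 - q ^ (n + 1))⁻¹ by rw [mul_pow]; ring]
  refine h.congr_fun fun r => ?_
  rw [lambertTerm, mul_pow, ← pow_mul, ← pow_mul, mul_comm r]
  ring

lemma hasSum_lambertTerm_left {y q : ℂ} (hq : ‖q‖ < 1) (hqy : ‖q * y‖ < 1) (r : ℕ) :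
    HasSum (fun n => lambertTerm y q n r) (-Complex.log (1 - q * y * q ^ r)) := by
  refine hasSum_pow_succ_div ?_
  rw [norm_mul, norm_pow]
  exact (mul_le_of_le_one_right (norm_nonneg _) (pow_le_one₀ (norm_nonneg _) hq.le)).trans_lt hqy

/-- Two orders of summation of one double series: over `r` it is geometric, over `n` it is the
logarithm series. -/
lemma hasSum_lambert {y q : ℂ} (hq : ‖q‖ < 1) (hqy : ‖q * y‖ < 1) :
    HasSum (fun n : ℕ => y ^ (n + 1) / (n + 1) * (q ^ (n + 1) / (1 - q ^ (n + 1))))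
      (-logQPochhammer (q * y) q) := by
  obtain ⟨S, hS⟩ := summable_lambertTerm hq hqy
  have hS' : HasSum (fun p : ℕ × ℕ => lambertTerm y q p.2 p.1) S :=
    (Equiv.prodComm ℕ ℕ).hasSum_iff.2 hS
  have h3 : S = -logQPochhammer (q * y) q :=
    (hS'.prod_fiberwise fun r => hasSum_lambertTerm_left hq hqy r).unique
      (summable_log_qPochhammer (q * y) hq).hasSum.neg
  exact h3 ▸ hS.prod_fiberwise fun n => hasSum_lambertTerm_right hq n

/-- The bookkeeping of exponents: a symmetric matrix `G` with vanishing row sums. -/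
lemma exponent_identity {N : ℕ} {G P : Fin N → Fin N → ℂ} (L : Fin N → Fin N → ℂ)
    (x m : Fin N → ℂ) {p : ℂ} (K c : ℂ) (hG : ∀ i j, G i j = G j i) (hsum : ∀ i, ∑ j, G i j = 0)
    (hP : ∀ i, P i i = p) :
    (∑ i, ∑ j ∈ Ioi i, G i j * L i j) + (∑ i, ∑ j, G i j * P i j)
        + ∑ i, c * (m i * x i + ∑ j ∈ Ioi i, G i j * x i)
      = ∑ i, (G i i / 2 * (K + 3 * p) + c * ((m i - G i i / 2) * x i))
        + ∑ i, ∑ j ∈ Ioi i, G i j * (K + c / 2 * (x i - x j) + p + (L i j + P i j) + P j i) := by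
  have hsplit : ∀ F : Fin N → Fin N → ℂ,
      ∑ i, ∑ j, F i j = ∑ i, F i i + ∑ i, ∑ j ∈ Ioi i, (F i j + F j i) := fun F => by
    have h := sum_sum_Ioi_add_eq_sum_sum_off_diag fun j i => F i j
    rw [h, ← sum_add_distrib]
    exact sum_congr rfl fun i _ => Fintype.sum_eq_add_sum_compl i _
  -- Split into diagonal and pairs, these two say that `∑ G_ii = -2 ∑_{i<j} G_ij`, and similarly
  -- with the weights `x`. The first cancels `K` and turns the coefficient `3/2` of `p ∑ G_ii` into
  -- 1, which accounts for the cube of η; the second yields the half-differences `c/2 (x_i - x_j)`.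
  have h1 : ∑ i, ∑ j, G i j = 0 := sum_eq_zero fun i _ => hsum i
  have h2 : ∑ i, ∑ j, G i j * x i = 0 :=
    sum_eq_zero fun i _ => by rw [← sum_mul, hsum, zero_mul]
  rw [hsplit] at h1 h2
  rw [hsplit fun i j => G i j * P i j]
  have e1 : ∑ i, ∑ j ∈ Ioi i, (G i j + G j i) = 2 * ∑ i, ∑ j ∈ Ioi i, G i j := by
    simp only [mul_sum]
    exact sum_congr rfl fun i _ => sum_congr rfl fun j _ => by rw [hG j i]; ring
  have e2 : ∑ i, ∑ j ∈ Ioi i, (G i j * x i + G j i * x j)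
      = 2 * (∑ i, ∑ j ∈ Ioi i, G i j * x i)
        - ∑ i, ∑ j ∈ Ioi i, G i j * (x i - x j) := by
    simp only [mul_sum, ← sum_sub_distrib]
    exact sum_congr rfl fun i _ => sum_congr rfl fun j _ => by rw [hG j i]; ring
  have e3 : ∑ i, ∑ j ∈ Ioi i, G i j * (K + c / 2 * (x i - x j) + p + (L i j + P i j) + P j i)
      = (K + p) * (∑ i, ∑ j ∈ Ioi i, G i j)
        + c / 2 * (∑ i, ∑ j ∈ Ioi i, G i j * (x i - x j))
        + (∑ i, ∑ j ∈ Ioi i, G i j * L i j)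
        + ∑ i, ∑ j ∈ Ioi i, (G i j * P i j + G j i * P j i) := by
    simp only [mul_sum, ← sum_add_distrib]
    exact sum_congr rfl fun i _ => sum_congr rfl fun j _ => by rw [hG j i]; ring
  have e4 : ∑ i, c * (m i * x i + ∑ j ∈ Ioi i, G i j * x i)
      = c * (∑ i, m i * x i) + c * ∑ i, ∑ j ∈ Ioi i, G i j * x i := by
    simp only [mul_add, sum_add_distrib, mul_sum]
  have e5 : ∑ i, (G i i / 2 * (K + 3 * p) + c * ((m i - G i i / 2) * x i))
      = (K + 3 * p) / 2 * (∑ i, G i i) + c * (∑ i, m i * x i)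
        - c / 2 * ∑ i, G i i * x i := by
    simp only [mul_sum, ← sum_add_distrib, ← sum_sub_distrib]
    exact sum_congr rfl fun i _ => by ring
  have e6 : ∑ i, G i i * P i i = p * ∑ i, G i i := by
    rw [mul_sum]
    exact sum_congr rfl fun i _ => by rw [hP, mul_comm]
  rw [e1] at h1
  rw [e2] at h2
  rw [e3, e4, e5, e6]
  linear_combination (-(K + p) / 2) * h1 + c / 2 * h2

end Exponents

/-! ### The one-loop trace -/

section Trace

variable {ι V : Type*} [AddCommGroup V] [Module ℂ V] (κ : ℂ)
  (B : LinearMap.BilinForm ℂ V) (b : Module.Basis ι ℂ V)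

lemma annihilationCoeff_mul_creationCoeff (h h' : V) (z z' : ℂ) (i : ι) (n : ℕ) :
    annihilationCoeff B b h z (i, n.succPNat) * creationCoeff κ b h' z' (i, n.succPNat)
      = -(b.repr h' i * B h (b i) / κ) * ((z' / z) ^ (n + 1) / (n + 1)) := by
  rw [annihilationCoeff, creationCoeff, Nat.succPNat_coe, Nat.succ_eq_add_one, div_pow]
  push_cast
  rw [div_eq_mul_inv, div_eq_mul_inv, div_eq_mul_inv, div_eq_mul_inv, mul_inv]
  ring

lemma expTwoPiI_oscillatorEnergy_mul (α : (ι × ℕ+) →₀ ℕ) (τ : ℂ) :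
    expTwoPiI (oscillatorEnergy α * τ) = α.prod fun m a => (expTwoPiI τ ^ (m.2 : ℕ)) ^ a := by
  rw [expTwoPiI, oscillatorEnergy, Finsupp.sum, sum_mul, mul_sum, Complex.exp_sum, Finsupp.prod]
  refine prod_congr rfl fun m _ => ?_
  rw [← pow_mul, ← expTwoPiI_nat_mul, expTwoPiI]
  congr 1
  push_cast
  ring

variable [Fintype ι]

lemma sum_repr_mul_apply (h h' : V) : ∑ i, b.repr h' i * B h (b i) = B h h' := by
  conv_rhs => rw [← b.sum_repr h']
  simp only [map_sum, map_smul, smul_eq_mul]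

/-- The sum over the basis contracts to `(h|h')`, leaving a power series in `z'/z`. The weight `φ`
is 1 for reordering vertex operators and `q^n/(1-q^n)` for the trace. -/
lemma hasSum_annihilationCoeff_mul_creationCoeff (h h' : V) (z z' : ℂ) (φ : ℕ+ → ℂ) {S : ℂ}
    (hS : HasSum (fun n : ℕ => (z' / z) ^ (n + 1) / (n + 1) * φ n.succPNat) S) :
    HasSum (fun m : ι × ℕ+ => annihilationCoeff B b h z m * creationCoeff κ b h' z' m * φ m.2)
      (-(B h h' / κ) * S) := by
  rw [← sum_repr_mul_apply B b h h', sum_div, ← sum_neg_distrib, sum_mul]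
  refine hasSum_prod_of_fintype fun i => hasSum_pnat_iff.2 ?_
  refine (hS.mul_left _).congr_fun fun n => ?_
  rw [annihilationCoeff_mul_creationCoeff, mul_assoc]

lemma norm_div_one_sub_pow {q : ℂ} (hq : ‖q‖ < 1) (n : ℕ) :
    ‖(‖q‖ : ℂ) ^ (n + 1) / (1 - (‖q‖ : ℂ) ^ (n + 1))‖
      = ‖q ^ (n + 1)‖ / (1 - ‖q ^ (n + 1)‖) := by
  have h : 0 < 1 - ‖q‖ ^ (n + 1) :=
    sub_pos.2 (pow_lt_one₀ (norm_nonneg _) hq n.succ_ne_zero)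
  have h1 : (‖q‖ : ℂ) ^ (n + 1) / (1 - (‖q‖ : ℂ) ^ (n + 1))
      = ((‖q‖ ^ (n + 1) / (1 - ‖q‖ ^ (n + 1)) : ℝ) : ℂ) := by push_cast; rfl
  rw [h1, Complex.norm_real, Real.norm_of_nonneg (by positivity), norm_pow]

lemma summable_norm_annihilationCoeff_mul_creationCoeff {q : ℂ} (hq : ‖q‖ < 1) (h h' : V)
    {z z' : ℂ} (hz : ‖q * (z' / z)‖ < 1) :
    Summable fun m : ι × ℕ+ => ‖annihilationCoeff B b h z m * creationCoeff κ b h' z' m‖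
      * ‖q ^ (m.2 : ℕ)‖ / (1 - ‖q ^ (m.2 : ℕ)‖) := by
  -- The Lambert series at the norms of `z'/z` and `q` is a majorant.
  have h1 := (hasSum_lambert (y := (‖z' / z‖ : ℂ)) (q := (‖q‖ : ℂ)) (by simpa using hq)
    (by simpa using hz)).summable.norm
  have h2 : ∀ i : ι, HasSum (fun p : ℕ+ =>
      ‖annihilationCoeff B b h z (i, p) * creationCoeff κ b h' z' (i, p)‖
        * ‖q ^ (p : ℕ)‖ / (1 - ‖q ^ (p : ℕ)‖))
      (∑' n : ℕ, ‖-(b.repr h' i * B h (b i) / κ)‖ * ‖(‖z' / z‖ : ℂ) ^ (n + 1) / (n + 1)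
        * ((‖q‖ : ℂ) ^ (n + 1) / (1 - (‖q‖ : ℂ) ^ (n + 1)))‖) := by
    intro i
    refine hasSum_pnat_iff.2 ((h1.mul_left _).hasSum.congr_fun fun n => ?_)
    rw [annihilationCoeff_mul_creationCoeff, Nat.succPNat_coe, norm_mul, norm_mul,
      norm_div_one_sub_pow hq, mul_assoc, mul_div_assoc]
    simp [mul_div_assoc]
  exact (hasSum_prod_of_fintype h2).summable

lemma summable_norm_div_one_sub {q : ℂ} (hq : ‖q‖ < 1) :
    Summable fun m : ι × ℕ+ => ‖q ^ (m.2 : ℕ)‖ / (1 - ‖q ^ (m.2 : ℕ)‖) := by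
  have h1 : Summable fun n : ℕ => ‖q ^ (n + 1)‖ / (1 - ‖q ^ (n + 1)‖) := by
    have hq1 : 0 < 1 - ‖q‖ := sub_pos.2 hq
    refine Summable.of_nonneg_of_le (fun n => ?_) (fun n => ?_)
      ((summable_geometric_of_lt_one (norm_nonneg q) hq).mul_right (1 - ‖q‖)⁻¹)
    · have := (pow_lt_one₀ (norm_nonneg q) hq n.succ_ne_zero).le
      rw [norm_pow]
      exact div_nonneg (by positivity) (sub_nonneg.2 this)
    · rw [norm_pow, ← div_eq_mul_inv]
      have h2 : ‖q‖ ^ (n + 1) ≤ ‖q‖ ^ n := pow_le_pow_of_le_one (norm_nonneg _) hq.le (Nat.le_succ n)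
      have h3 : ‖q‖ ^ (n + 1) ≤ ‖q‖ := pow_le_of_le_one (norm_nonneg _) hq.le n.succ_ne_zero
      exact div_le_div₀ (by positivity) h2 hq1 (by linarith)
  exact (hasSum_prod_of_fintype (f := fun m : ι × ℕ+ =>
    ‖q ^ (m.2 : ℕ)‖ / (1 - ‖q ^ (m.2 : ℕ)‖)) fun _ => hasSum_pnat_iff.2 h1.hasSum).summable

lemma tsum_log_one_sub_pow {q : ℂ} (hq : ‖q‖ < 1) :
    ∑' m : ι × ℕ+, Complex.log (1 - q ^ (m.2 : ℕ)) = Fintype.card ι * logQPochhammer q q := by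
  have h : HasSum (fun p : ℕ+ => Complex.log (1 - q ^ (p : ℕ))) (logQPochhammer q q) :=
    hasSum_pnat_iff.2 ((summable_log_qPochhammer q hq).hasSum.congr_fun fun n => by
      rw [Nat.succPNat_coe, Nat.succ_eq_add_one, pow_succ'])
  have h2 := (hasSum_prod_of_fintype (ι := ι)
    (f := fun m : ι × ℕ+ => Complex.log (1 - q ^ (m.2 : ℕ))) fun _ => h).tsum_eq
  rw [h2, sum_const, card_univ, nsmul_eq_mul]

lemma expTwoPiI_eq_exp (x : ℂ) : expTwoPiI x = Complex.exp (2 * Real.pi * Complex.I * x) := rfl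

variable {κ} {B}

variable {N : ℕ} {μs : Fin N → V} {x : Fin N → ℂ} {τ : ℂ}

/-- `z_j/z_i` is small for `i < j`, and `q z_j/z_i` is always small. -/
lemma norm_ratio_lt_one (hτ : 0 < τ.im)
    (hx : ∀ i j, i < j → ‖expTwoPiI (x j)‖ < ‖expTwoPiI (x i)‖ ∧
      ‖expTwoPiI τ * expTwoPiI (x i)‖ < ‖expTwoPiI (x j)‖) :
    (∀ i j, i < j → ‖expTwoPiI (x j) / expTwoPiI (x i)‖ < 1) ∧
      ∀ i j, ‖expTwoPiI τ * (expTwoPiI (x j) / expTwoPiI (x i))‖ < 1 := by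
  have hpos : ∀ i, 0 < ‖expTwoPiI (x i)‖ := fun i => norm_pos_iff.2 (expTwoPiI_ne_zero _)
  have h1 : ∀ i j, i < j → ‖expTwoPiI (x j) / expTwoPiI (x i)‖ < 1 := fun i j hij => by
    rw [norm_div, div_lt_one (hpos i)]
    exact (hx i j hij).1
  refine ⟨h1, fun i j => ?_⟩
  rcases lt_trichotomy i j with h | rfl | h
  · rw [norm_mul]
    exact mul_lt_one_of_nonneg_of_lt_one_left (norm_nonneg _) (norm_expTwoPiI_lt_one hτ)
      (h1 i j h).le
  · rw [div_self (expTwoPiI_ne_zero _), mul_one]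
    exact norm_expTwoPiI_lt_one hτ
  · rw [← mul_div_assoc, norm_div, div_lt_one (hpos i)]
    exact (hx j i h).2

lemma hasSum_annihilationCoeff_mul_creationCoeff_log (h h' : V) {z z' : ℂ}
    (hz : ‖z' / z‖ < 1) :
    HasSum (fun m : ι × ℕ+ => annihilationCoeff B b h z m * creationCoeff κ b h' z' m)
      (B h h' / κ * Complex.log (1 - z' / z)) := by
  have h := hasSum_annihilationCoeff_mul_creationCoeff κ B b h h' z z' (fun _ => 1)
    (by simpa using hasSum_pow_succ_div hz)
  simpa using h

lemma hasSum_creation_mul_annihilation_lambert (hτ : 0 < τ.im)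
    (hz : ∀ i j, ‖expTwoPiI τ * (expTwoPiI (x j) / expTwoPiI (x i))‖ < 1) :
    HasSum (fun m : ι × ℕ+ => (∑ k, creationCoeff κ b (μs k) (expTwoPiI (x k))) m
        * (∑ j, annihilationCoeff B b (μs j) (expTwoPiI (x j))) m
        * expTwoPiI τ ^ (m.2 : ℕ) / (1 - expTwoPiI τ ^ (m.2 : ℕ)))
      (∑ j, ∑ k, B (μs j) (μs k) / κ
        * logQPochhammer (expTwoPiI τ * (expTwoPiI (x k) / expTwoPiI (x j))) (expTwoPiI τ)) := by
  have h : ∀ j ∈ (univ : Finset (Fin N)), ∀ k ∈ (univ : Finset (Fin N)), _ := fun j _ k _ =>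
    hasSum_annihilationCoeff_mul_creationCoeff κ B b (μs j) (μs k) (expTwoPiI (x j))
      (expTwoPiI (x k)) (fun p => expTwoPiI τ ^ (p : ℕ) / (1 - expTwoPiI τ ^ (p : ℕ)))
      (hasSum_lambert (norm_expTwoPiI_lt_one hτ) (hz j k))
  have h2 := hasSum_sum fun j hj => hasSum_sum (h j hj)
  simp only [neg_mul_neg] at h2
  refine h2.congr_fun fun m => ?_
  rw [Finset.sum_apply, Finset.sum_apply, mul_comm (∑ k, _), sum_mul_sum, mul_div_assoc, sum_mul]
  exact sum_congr rfl fun j _ => sum_mul _ _ _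

lemma summable_norm_creation_mul_annihilation (hτ : 0 < τ.im)
    (hz : ∀ i j, ‖expTwoPiI τ * (expTwoPiI (x j) / expTwoPiI (x i))‖ < 1) :
    Summable (fun m : ι × ℕ+ => ‖(∑ k, creationCoeff κ b (μs k) (expTwoPiI (x k))) m
        * (∑ j, annihilationCoeff B b (μs j) (expTwoPiI (x j))) m‖
        * ‖expTwoPiI τ ^ (m.2 : ℕ)‖ / (1 - ‖expTwoPiI τ ^ (m.2 : ℕ)‖)) := by
  have hq := norm_expTwoPiI_lt_one hτ
  have h := summable_sum fun j (_ : j ∈ (univ : Finset (Fin N))) => summable_sum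
    fun k (_ : k ∈ (univ : Finset (Fin N))) =>
      summable_norm_annihilationCoeff_mul_creationCoeff κ B b hq (μs j) (μs k) (hz j k)
  have hnn : ∀ m : ι × ℕ+, 0 ≤ ‖expTwoPiI τ ^ (m.2 : ℕ)‖ / (1 - ‖expTwoPiI τ ^ (m.2 : ℕ)‖) :=
    fun m => by
      have := (pow_lt_one₀ (norm_nonneg (expTwoPiI τ)) hq m.2.ne_zero).le
      rw [norm_pow]
      exact div_nonneg (by positivity) (sub_nonneg.2 this)
  refine Summable.of_nonneg_of_le (fun m => ?_) (fun m => ?_) h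
  · rw [mul_div_assoc]
    exact mul_nonneg (norm_nonneg _) (hnn m)
  · simp only [mul_div_assoc, ← sum_mul]
    refine mul_le_mul_of_nonneg_right ?_ (hnn m)
    rw [Finset.sum_apply, Finset.sum_apply, mul_comm, sum_mul_sum]
    exact (norm_sum_le _ _).trans (sum_le_sum fun j _ => norm_sum_le _ _)

/-- The exponent of the one-loop trace. -/
lemma oneLoop_exponent (hs : B.IsSymm) (hμs : ∑ i, μs i = 0) (μ : V) (hτ : 0 < τ.im) :
    (∑ i, ∑ j ∈ Ioi i, B (μs i) (μs j) / κ
        * Complex.log (1 - expTwoPiI (x j) / expTwoPiI (x i)))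
      + (∑ i, ∑ j, B (μs i) (μs j) / κ
        * logQPochhammer (expTwoPiI τ * (expTwoPiI (x j) / expTwoPiI (x i))) (expTwoPiI τ))
      + ∑ i, 2 * Real.pi * Complex.I * (B (μ + ∑ j ∈ Ioi i, μs j) (μs i) / κ * x i)
    = ∑ i, (B (μs i) (μs i) / (2 * κ) * logIEtaCubed τ
        + 2 * Real.pi * Complex.I * (B (μs i) ((2 : ℂ) • μ - μs i) / (2 * κ) * x i))
      + ∑ i, ∑ j ∈ Ioi i, B (μs i) (μs j) / κ * logTheta11 (x i - x j) τ := by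
  have hq := norm_expTwoPiI_lt_one hτ
  -- Here `K = πi/2 + 2πiτ/8` is common to both logarithms: `K + 3p` is `logIEtaCubed τ`.
  have key := exponent_identity (G := fun i j => B (μs i) (μs j) / κ)
    (P := fun i j =>
      logQPochhammer (expTwoPiI τ * (expTwoPiI (x j) / expTwoPiI (x i))) (expTwoPiI τ))
    (fun i j => Complex.log (1 - expTwoPiI (x j) / expTwoPiI (x i))) x
    (fun i => B μ (μs i) / κ) (p := logQPochhammer (expTwoPiI τ) (expTwoPiI τ))
    (Real.pi * Complex.I / 2 + 2 * Real.pi * Complex.I * τ / 8) (2 * Real.pi * Complex.I)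
    (fun i j => by rw [hs.eq])
    (fun i => by rw [← sum_div, ← map_sum, hμs, map_zero, zero_div])
    (fun i => by rw [div_self (expTwoPiI_ne_zero _), mul_one])
  convert! key using 1
  · congr 1
    refine sum_congr rfl fun i _ => ?_
    rw [map_add, map_sum, LinearMap.add_apply, LinearMap.sum_apply, add_div, sum_div, add_mul,
      sum_mul]
    simp only [hs.eq (μs i)]
  · congr 1
    · refine sum_congr rfl fun i _ => ?_
      rw [logIEtaCubed, map_sub, map_smul, smul_eq_mul, hs.eq (μs i) μ]
      ring
    · refine sum_congr rfl fun i _ => sum_congr rfl fun j _ => ?_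
      -- The reordering logarithm `L i j` is the missing `n = 0` term of `log (z_j/z_i;q)_∞`; `P j
      -- i` is `log (q z_i/z_j;q)_∞`.
      rw [← logQPochhammer_eq_add hq, logTheta11, expTwoPiI_sub, inv_div]
      ring

variable [DecidableEq ι] (hB : B.Nondegenerate)

/-- The eigenvalues of `q^{T[0]} e^{φ[H;0]}`. -/
def tailEigenvalue (κ : ℂ) (B : LinearMap.BilinForm ℂ V) (ρ H : V) (τ : ℂ)
    (s : FockState ι V) : ℂ :=
  expTwoPiI (B s.1 (s.1 + (2 : ℂ) • ρ) / (2 * κ) * τ) * Complex.exp (B s.1 H)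
    * expTwoPiI (oscillatorEnergy s.2 * τ)

/-- Both operators are diagonal, so each intermediate sum has one term. The result is put in the
form that `opProd_gaussOp` expects of its tail. -/
lemma opProd_tail (hκ : κ ≠ 0) (hs : B.IsSymm) (ρ H : V) (τ : ℂ) :
    OpProdConverges [ opExp (fun s t => 2 * Real.pi * Complex.I * τ
        * energyZeroMode κ B hB b ρ s t), opExp (toOp (phi κ B b H 0)) ] ∧
    ∀ s t, opProd [ opExp (fun s t => 2 * Real.pi * Complex.I * τ
        * energyZeroMode κ B hB b ρ s t), opExp (toOp (phi κ B b H 0)) ] s t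
      = gaussOp 0 0 0 1 s t * tailEigenvalue κ B ρ H τ t := by
  have h1 : (fun s t => 2 * Real.pi * Complex.I * τ * energyZeroMode κ B hB b ρ s t)
      = (diagOp fun s => 2 * Real.pi * Complex.I * τ * (B s.1 (s.1 + (2 : ℂ) • ρ) / (2 * κ)
        + oscillatorEnergy s.2) : FockOp ι V) := by
    funext s t
    rw [energyZeroMode_eq_diagOp b hB hκ hs, diagOp, diagOp, mul_ite, mul_zero]
  rw [h1, toOp_phi_zero, opExp_diagOp, opExp_diagOp]
  refine ⟨⟨fun s t => summable_diagOp_mul _ _ s t, fun s t => summable_diagOp_mul _ _ s t,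
    trivial⟩, fun s t => ?_⟩
  simp only [opProd, opMul_diagOp, gaussOp_zero]
  by_cases h : s = t
  · subst h
    simp only [opOne, diagOp, if_true, tailEigenvalue, expTwoPiI_eq_exp, ← Complex.exp_add,
      Pi.one_apply, mul_one, one_mul]
    congr 1
    ring
  · simp [opOne, diagOp, if_neg h]

/-- The one-loop trace of vertex operators. -/
theorem oneLoop_trace (hκ : κ ≠ 0) (hs : B.IsSymm) (ρ H μ : V) (hμs : ∑ i, μs i = 0)
    (hτ : 0 < τ.im)
    (hx : ∀ i j, i < j → ‖expTwoPiI (x j)‖ < ‖expTwoPiI (x i)‖ ∧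
      ‖expTwoPiI τ * expTwoPiI (x i)‖ < ‖expTwoPiI (x j)‖) :
    OpProdConverges (oneLoopOps κ B hB b ρ H μs x τ) ∧
      HasFockTrace μ (opProd (oneLoopOps κ B hB b ρ H μs x τ))
        (oneLoopFormula κ B ρ H μ μs x τ) := by
  have hq := norm_expTwoPiI_lt_one hτ
  obtain ⟨hz, hqz⟩ := norm_ratio_lt_one hτ hx
  obtain ⟨hL, hQ⟩ := opProd_tail b hB hκ hs ρ H τ
  have hsum : ∀ i j, i < j → HasSum (fun m : ι × ℕ+ =>
      annihilationCoeff B b (μs i) (expTwoPiI (x i)) m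
        * creationCoeff κ b (μs j) (expTwoPiI (x j)) m) _ := fun i j hij =>
    hasSum_annihilationCoeff_mul_creationCoeff_log b (μs i) (μs j) (hz i j hij)
  obtain ⟨hconv, hprod⟩ := opProd_gaussOp hL hQ μs
    (fun i => creationCoeff κ b (μs i) (expTwoPiI (x i)))
    (fun i => annihilationCoeff B b (μs i) (expTwoPiI (x i)))
    (fun i lam => expTwoPiI (B lam (μs i) / κ * x i)) fun i j hij => (hsum i j hij).summable
  simp only [oneLoopOps, vertexOp_eq_gaussOp B b hκ]
  refine ⟨hconv, ?_⟩
  have hdiag := (hasSum_gaussKernel_diag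
    (w := fun m : ι × ℕ+ => expTwoPiI τ ^ (m.2 : ℕ))
    (fun m => by rw [norm_pow]; exact pow_lt_one₀ (norm_nonneg _) hq m.2.ne_zero)
    (summable_norm_div_one_sub hq)
    (summable_norm_creation_mul_annihilation (B := B) (κ := κ) (μs := μs) b hτ hqz)).mul_left
    (Complex.exp (∑ i, ∑ j ∈ Ioi i, ∑' m : ι × ℕ+,
      annihilationCoeff B b (μs i) (expTwoPiI (x i)) m
        * creationCoeff κ b (μs j) (expTwoPiI (x j)) m)
      * (∏ i, expTwoPiI (B (μ + ∑ j ∈ Ioi i, μs j) (μs i) / κ * x i))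
      * (expTwoPiI (B μ (μ + (2 : ℂ) • ρ) / (2 * κ) * τ) * Complex.exp (B μ H)))
  rw [HasFockTrace]
  convert! hdiag using 1
  · funext α
    -- The total momentum shift is `∑ μ_i = 0`, so diagonal entries survive.
    rw [hprod, gaussOp, hμs, if_pos (add_zero μ).symm, tailEigenvalue,
      expTwoPiI_oscillatorEnergy_mul]
    ring
  · rw [sum_congr rfl fun i _ => sum_congr rfl fun j hj => (hsum i j (mem_Ioi.1 hj)).tsum_eq,
      (hasSum_creation_mul_annihilation_lambert b hτ hqz).tsum_eq, tsum_log_one_sub_pow hq]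
    -- The exponents agree as complex numbers; exponentiation then gives the products of powers with
    -- the prescribed branches.
    have hexp := congrArg Complex.exp (oneLoop_exponent (κ := κ) (x := x) hs hμs μ hτ)
    simp only [Complex.exp_add, Complex.exp_sum, Complex.exp_sub, Complex.exp_nat_mul,
      exp_logQPochhammer hq (one_sub_mul_pow_ne_zero hq hq), ← expTwoPiI_eq_exp] at hexp ⊢
    rw [oneLoopFormula, Module.finrank_eq_card_basis b, hs.eq H μ]
    rw [prod_mul_distrib] at hexp ⊢
    linear_combination (-(qPochhammer (expTwoPiI τ) (expTwoPiI τ) ^ Fintype.card ι)⁻¹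
      * expTwoPiI (B μ (μ + (2 : ℂ) • ρ) / (2 * κ) * τ) * Complex.exp (B μ H)) * hexp

end Trace

end OneLoop

end

/-! ### Specialization to the Cartan subalgebra of a simple Lie algebra. -/

theorem mainTheorem5 {𝔤 : Type*} [LieRing 𝔤] [LieAlgebra ℂ 𝔤] [FiniteDimensional ℂ 𝔤]
    [LieAlgebra.IsSimple ℂ 𝔤] (𝔥 : LieSubalgebra ℂ 𝔤) [𝔥.IsCartanSubalgebra]
    (base : (LieAlgebra.IsKilling.rootSystem 𝔥).Base) {c : ℂ} (hc : c ≠ 0)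
    {ι : Type*} [Fintype ι] [DecidableEq ι] (b : Module.Basis ι ℂ 𝔥)
    (κ : ℂ) (hκ : κ ≠ 0) (H μ : 𝔥) {N : ℕ} (μs : Fin N → 𝔥) (hμs : ∑ i, μs i = 0)
    (x : Fin N → ℂ) (τ : ℂ) (hτ : 0 < τ.im)
    (hx : ∀ i j, i < j → ‖OneLoop.expTwoPiI (x j)‖ < ‖OneLoop.expTwoPiI (x i)‖ ∧
      ‖OneLoop.expTwoPiI τ * OneLoop.expTwoPiI (x i)‖ < ‖OneLoop.expTwoPiI (x j)‖) :
    OneLoop.OpProdConverges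
        (OneLoop.oneLoopOps κ (OneLoop.cartanForm 𝔥 c) (OneLoop.cartanForm_nondegenerate 𝔥 hc) b
          (OneLoop.weylVector 𝔥 base hc) H μs x τ) ∧
      OneLoop.HasFockTrace μ
        (OneLoop.opProd
          (OneLoop.oneLoopOps κ (OneLoop.cartanForm 𝔥 c) (OneLoop.cartanForm_nondegenerate 𝔥 hc) b
            (OneLoop.weylVector 𝔥 base hc) H μs x τ))
        (OneLoop.oneLoopFormula κ (OneLoop.cartanForm 𝔥 c) (OneLoop.weylVector 𝔥 base hc)
          H μ μs x τ) ∧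
      Complex.exp (OneLoop.logIEtaCubed τ) = Complex.I * OneLoop.dedekindEta τ ^ 3 ∧
      ∀ i j, i < j →
        Complex.exp (OneLoop.logTheta11 (x i - x j) τ) = OneLoop.theta11 (x i - x j) τ := by
  have hs : (OneLoop.cartanForm 𝔥 c).IsSymm := ⟨fun v w => by
    simp only [OneLoop.cartanForm, LinearMap.smul_apply]
    rw [LieModule.traceForm_comm]⟩
  obtain ⟨h1, h2⟩ := OneLoop.oneLoop_trace b (OneLoop.cartanForm_nondegenerate 𝔥 hc) hκ hs
    (OneLoop.weylVector 𝔥 base hc) H μ hμs hτ hx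
  obtain ⟨hz, hqz⟩ := OneLoop.norm_ratio_lt_one hτ hx
  refine ⟨h1, h2, OneLoop.exp_logIEtaCubed hτ, fun i j hij => OneLoop.exp_logTheta11 hτ ?_ ?_⟩
  · rw [OneLoop.expTwoPiI_sub, inv_div]
    exact hz i j hij
  · rw [OneLoop.expTwoPiI_sub]
    -- The indices are exchanged: the bound needed is on `q z_i/z_j` with `i < j`, where the
    -- condition `|q z_i| < |z_j|` enters.
    exact hqz j i
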